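/- Let $L\ge 1$, $p\in(0,1)$, and let $\alpha\in M_L(\mathbb C)$ have spectral norm $<1$; put $\rho=(1-\alpha\alpha^*)^{1/2}$, $\tilde\rho=(1-\alpha^*\alpha)^{1/2}$. Let $(\widetilde V^{(n)},d^{(n)},\theta^{(n)},\widetilde U^{(n)},D^{(n)},\Theta^{(n)})_{n\in\mathbb Z}$ be independent and identically distributed in $n$, with six independent components: $\widetilde V^{(n)},\widetilde U^{(n)}$ are Haar distributed on the unitary group $U(L)$; $d^{(n)},D^{(n)}\in\{-1,1\}^L$ have independent entries equal to $1$ with probability $p$ and to $-1$ with probability $1-p$; $\theta^{(n)},\Theta^{(n)}\in[0,2\pi]^L$ have independent uniformly distributed entries (tuples are identified with diagonal matrices). Set $$U^{(n)}_\omega=e^{i\Theta^{(n)}}\widetilde U^{(n)}D^{(n)}(\widetilde U^{(n)})^*,\qquad V^{(n)}_\omega=\widetilde V^{(n)}d^{(n)}(\widetilde V^{(n)})^*e^{i\theta^{(n)}},\qquad S^{(n)}_\omega=\begin{pmatrix}\alpha&\rho\,U^{(n)}_\omega\\ V^{(n)}_\omega\tilde\rho&-V^{(n)}_\omega\alpha^*U^{(n)}_\omega\end{pmatrix}.$$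 For $a<b$ in $\mathbb Z\cup\{\pm\infty\}$ and $B_-,B_+\in U(L)$, let $\mathbb U^{[a,b]}_\omega=\mathbb V^{[a,b]}_\omega\mathbb W^{[a,b]}_\omega$ on $\ell^2([a,b]\cap\mathbb Z,\mathbb C^L)$, where $\mathbb V^{[a,b]}_\omega$ (resp. $\mathbb W^{[a,b]}_\omega$) is the direct sum of the matrices $S^{(n)}_\omega$ with $n$ even (resp. odd), acting on the pair of sites $(n,n+1)$, over all such pairs contained in $[a,b]$, completed by $B_-$ at the site $a$ if its pair is $\{a-1,a\}$ and by $B_+$ at the site $b$ if its pair is $\{b,b+1\}$. (So each finite endpoint carries exactly one boundary condition, and for $a=-\infty$, $b=+\infty$ there is none.) Let $\|\cdot\|$ be a norm on $M_L(\mathbb C)$ subordinate to some norm on $\mathbb C^L$. Then for every $s\in(0,\tfrac14)$ there is $C(s)>0$, which may depend also on $L,p,\alpha$ and $\|\cdot\|$, such that for all $B_-,B_+\in U(L)$, every $z\in\mathbb C$ with $|z|\ne1$, and all $a<b$ in $\mathbb Z\cup\{\pm\infty\}$, the operator $\mathbb U^{[a,b]}_\omega-z$ is invertible for every $\omega$,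 and for all integers $k,l\in[a,b]$ with $|k-l|>4$ the $L\times L$ block $G^{[a,b]}_\omega(z,k,l)$ of $(\mathbb U^{[a,b]}_\omega-z)^{-1}$ in row $k$ and column $l$ satisfies $$\mathbb E\big(\|G^{[a,b]}_\omega(z,k,l)\|^s\big)\le C(s).$$ -/

import Mathlib

open MeasureTheory

namespace ScatteringZipper

/-! ### The probability space -/

/-- The unitary group `U(L)`. -/
abbrev UL (L : ℕ) : Type := Matrix.unitaryGroup (Fin L) ℂ

noncomputable instance instMeasurableSpaceUL (L : ℕ) : MeasurableSpace (UL L) := borel _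

instance instBorelSpaceUL (L : ℕ) : BorelSpace (UL L) := ⟨rfl⟩

instance instCompactSpaceUL (L : ℕ) : CompactSpace (UL L) := by
  have hK : IsCompact (Set.univ.pi fun _ : Fin L => Set.univ.pi fun _ : Fin L =>
      Metric.closedBall (0 : ℂ) 1) :=
    isCompact_univ_pi fun _ => isCompact_univ_pi fun _ => isCompact_closedBall _ _
  have hclosed : IsClosed ((Matrix.unitaryGroup (Fin L) ℂ : Set (Matrix (Fin L) (Fin L) ℂ))) := by
    have h : ((Matrix.unitaryGroup (Fin L) ℂ : Set (Matrix (Fin L) (Fin L) ℂ)))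
        = {A | A * star A = 1} := by
      ext A
      exact Matrix.mem_unitaryGroup_iff
    rw [h]
    exact isClosed_eq (by fun_prop) continuous_const
  refine isCompact_iff_compactSpace.mp (hK.of_isClosed_subset hclosed ?_)
  intro A hA i _ j _
  simpa using entry_norm_bound_of_unitary hA i j

/-- One half of the randomness attached to a site: an element of
`U(L) × {-1,1}^L × [0,2π]^L`. -/
abbrev HalfSample (L : ℕ) : Type :=
  UL L × (Fin L → ℤˣ) × (Fin L → Set.Icc (0 : ℝ) (2 * Real.pi))

/-- The randomness `ω_n = (Ṽ, d, θ, Ũ, D, Θ)` attached to a site; the first half is `(Ṽ, d, θ)`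
and the second half is `(Ũ, D, Θ)`. -/
abbrev SiteSample (L : ℕ) : Type := HalfSample L × HalfSample L

/-- The sample space `Ω`. -/
abbrev Sample (L : ℕ) : Type := ℤ → SiteSample L

/-- The Haar probability measure on `U(L)`. -/
noncomputable def haarU (L : ℕ) : Measure (UL L) := Measure.haarMeasure ⊤

/-- The Bernoulli law of parameter `p` on `{-1,1}`. -/
noncomputable def bernoulliSign (p : ℝ) : Measure ℤˣ :=
  ENNReal.ofReal p • Measure.dirac 1 + ENNReal.ofReal (1 - p) • Measure.dirac (-1)

/-- The uniform law on `[0,2π]`. -/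
noncomputable def uniformAngle : Measure (Set.Icc (0 : ℝ) (2 * Real.pi)) :=
  (ENNReal.ofReal (2 * Real.pi))⁻¹ • Measure.comap Subtype.val volume

noncomputable def halfLaw (L : ℕ) (p : ℝ) : Measure (HalfSample L) :=
  (haarU L).prod
    ((Measure.pi fun _ : Fin L => bernoulliSign p).prod (Measure.pi fun _ : Fin L => uniformAngle))

noncomputable def siteLaw (L : ℕ) (p : ℝ) : Measure (SiteSample L) :=
  (halfLaw L p).prod (halfLaw L p)

/-- The law `ℙ` on `Ω`: the sites are independent and identically distributed. -/
noncomputable def law (L : ℕ) (p : ℝ) : Measure (Sample L) :=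
  Measure.infinitePi fun _ : ℤ => siteLaw L p

instance isProbabilityMeasure_haarU (L : ℕ) : IsProbabilityMeasure (haarU L) :=
  ⟨Measure.haarMeasure_self⟩

theorem isProbabilityMeasure_bernoulliSign {p : ℝ} (h0 : 0 ≤ p) (h1 : p ≤ 1) :
    IsProbabilityMeasure (bernoulliSign p) :=
  ⟨by simp [bernoulliSign, ← ENNReal.ofReal_add h0 (sub_nonneg.2 h1)]⟩

instance isProbabilityMeasure_uniformAngle : IsProbabilityMeasure uniformAngle :=
  ⟨by
    have h : (Measure.comap Subtype.val volume : Measure (Set.Icc (0 : ℝ) (2 * Real.pi))) Set.univ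
        = ENNReal.ofReal (2 * Real.pi) := by
      rw [comap_subtype_coe_apply measurableSet_Icc, Set.image_univ, Subtype.range_coe,
        Real.volume_Icc, sub_zero]
    rw [uniformAngle, Measure.smul_apply, h, smul_eq_mul]
    exact ENNReal.inv_mul_cancel (by simp [Real.pi_pos]) ENNReal.ofReal_ne_top⟩

/-- `ℙ` is a probability measure: in particular `law` is the genuine infinite product. -/
theorem isProbabilityMeasure_law (L : ℕ) {p : ℝ} (h0 : 0 ≤ p) (h1 : p ≤ 1) :
    IsProbabilityMeasure (law L p) := by
  have := isProbabilityMeasure_bernoulliSign h0 h1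
  have : IsProbabilityMeasure (halfLaw L p) := by unfold halfLaw; infer_instance
  have : IsProbabilityMeasure (siteLaw L p) := by unfold siteLaw; infer_instance
  unfold law
  infer_instance

/-! ### The random phases and the scattering matrices -/

/-- A diagonal matrix with unimodular entries, as an element of `U(L)`. -/
def diagU {L : ℕ} (c : Fin L → ℂ) (hc : ∀ i, ‖c i‖ = 1) : UL L :=
  ⟨Matrix.diagonal c, by
    rw [Matrix.mem_unitaryGroup_iff, Matrix.star_eq_conjTranspose, Matrix.diagonal_conjTranspose,
      Matrix.diagonal_mul_diagonal, ← Matrix.diagonal_one]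
    congr 1
    funext i
    simp [Complex.mul_conj, Complex.normSq_eq_norm_sq, hc i]⟩

/-- The diagonal matrix of a tuple of signs. -/
def signU {L : ℕ} (d : Fin L → ℤˣ) : UL L :=
  diagU (fun i => ((d i : ℤ) : ℂ)) fun i => by
    rcases Int.units_eq_one_or (d i) with h | h <;> simp [h]

/-- The diagonal matrix `e^{iθ}` of a tuple of angles. -/
noncomputable def phaseU {L : ℕ} (θ : Fin L → Set.Icc (0 : ℝ) (2 * Real.pi)) : UL L :=
  diagU (fun i => Complex.exp (((θ i : ℝ) : ℂ) * Complex.I)) fun _ =>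
    Complex.norm_exp_ofReal_mul_I _

/-- `U^{(n)}_ω = e^{iΘ} Ũ D Ũ^*`. -/
noncomputable def Uph {L : ℕ} (ω : Sample L) (n : ℤ) : UL L :=
  phaseU (ω n).2.2.2 * (ω n).2.1 * signU (ω n).2.2.1 * (ω n).2.1⁻¹

/-- `V^{(n)}_ω = Ṽ d Ṽ^* e^{iθ}`. -/
noncomputable def Vph {L : ℕ} (ω : Sample L) (n : ℤ) : UL L :=
  (ω n).1.1 * signU (ω n).1.2.1 * (ω n).1.1⁻¹ * phaseU (ω n).1.2.2

/-- The fibre `ℂ^L`, with its Hermitian norm. -/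
abbrev Fib (L : ℕ) : Type := EuclideanSpace ℂ (Fin L)

/-- The operator on `ℂ^L` given by a matrix. -/
noncomputable abbrev op {L : ℕ} (A : Matrix (Fin L) (Fin L) ℂ) : Fib L →L[ℂ] Fib L :=
  Matrix.toEuclideanCLM (n := Fin L) (𝕜 := ℂ) A

open scoped MatrixOrder in
/-- `ρ(α) = (1 - α α^*)^{1/2}`. -/
noncomputable def rho {L : ℕ} (α : Matrix (Fin L) (Fin L) ℂ) : Matrix (Fin L) (Fin L) ℂ :=
  CFC.sqrt (1 - α * α.conjTranspose)

open scoped MatrixOrder in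
/-- `ρ̃(α) = (1 - α^* α)^{1/2}`. -/
noncomputable def rhoT {L : ℕ} (α : Matrix (Fin L) (Fin L) ℂ) : Matrix (Fin L) (Fin L) ℂ :=
  CFC.sqrt (1 - α.conjTranspose * α)

/-- The upper right block of `S^{(n)}_ω`. -/
noncomputable def blockB {L : ℕ} (α : Matrix (Fin L) (Fin L) ℂ) (ω : Sample L) (n : ℤ) :
    Matrix (Fin L) (Fin L) ℂ :=
  rho α * (Uph ω n : Matrix (Fin L) (Fin L) ℂ)

/-- The lower left block of `S^{(n)}_ω`. -/
noncomputable def blockC {L : ℕ} (α : Matrix (Fin L) (Fin L) ℂ) (ω : Sample L) (n : ℤ) :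
    Matrix (Fin L) (Fin L) ℂ :=
  (Vph ω n : Matrix (Fin L) (Fin L) ℂ) * rhoT α

/-- The lower right block of `S^{(n)}_ω`. -/
noncomputable def blockD {L : ℕ} (α : Matrix (Fin L) (Fin L) ℂ) (ω : Sample L) (n : ℤ) :
    Matrix (Fin L) (Fin L) ℂ :=
  -((Vph ω n : Matrix (Fin L) (Fin L) ℂ) * α.conjTranspose * (Uph ω n : Matrix (Fin L) (Fin L) ℂ))

/-! ### Operators on `ℓ²(I, ℂ^L)` -/

/-- The Hilbert space `ℓ²(I, ℂ^L)`. -/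
abbrev Hil (L : ℕ) (I : Set ℤ) : Type := lp (fun _ : I => Fib L) 2

/-- The block-diagonal operator `(f_i) ↦ (A_i f_i)`. -/
noncomputable def diagOp {L : ℕ} {I : Set ℤ} (A : I → Fib L →L[ℂ] Fib L)
    (hA : ∃ C, ∀ i, ‖A i‖ ≤ C) : Hil L I →L[ℂ] Hil L I :=
  have key : ∃ C : ℝ, 0 ≤ C ∧ ∀ (f : Hil L I) (i : I), ‖A i (f i)‖ ≤ C * ‖f i‖ := by
    obtain ⟨C, hC⟩ := hA
    refine ⟨max C 0, le_max_right _ _, fun f i => ?_⟩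
    exact (A i).le_of_opNorm_le ((hC i).trans (le_max_left _ _)) _
  have mem : ∀ f : Hil L I, Memℓp (fun i => A i (f i)) 2 := by
    obtain ⟨C, hC, h⟩ := key
    intro f
    refine Memℓp.mono' ((lp.memℓp f).const_smul (C : ℂ)) fun i => ?_
    simpa [norm_smul, abs_of_nonneg hC] using h f i
  LinearMap.mkContinuousOfExistsBound
    { toFun := fun f => (⟨fun i => A i (f i), mem f⟩ : Hil L I)
      map_add' := fun f g => by ext1; funext i; exact map_add (A i) _ _
      map_smul' := fun c f => by ext1; funext i; exact map_smul (A i) _ _ }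
    (by
      obtain ⟨C, hC, h⟩ := key
      refine ⟨C, fun f => ?_⟩
      have h2 : ‖(C : ℂ) • f‖ = C * ‖f‖ := by
        rw [norm_smul, Complex.norm_real, Real.norm_of_nonneg hC]
      rw [← h2]
      refine lp.norm_mono (by norm_num) fun i => ?_
      have h3 : ‖((C : ℂ) • f : Hil L I) i‖ = C * ‖f i‖ := by
        rw [lp.coeFn_smul, Pi.smul_apply, norm_smul, Complex.norm_real, Real.norm_of_nonneg hC]
      rw [h3]
      exact h f i)

/-- The operator `(f_i) ↦ (f_{σ(i)})` for an injective map `σ`. -/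
noncomputable def reindexOp {L : ℕ} {I : Set ℤ} (σ : I → I) (hσ : Function.Injective σ) :
    Hil L I →L[ℂ] Hil L I :=
  have mem : ∀ f : Hil L I, Memℓp (fun i => f (σ i)) 2 := fun f =>
    memℓp_gen (((lp.memℓp f).summable (by norm_num)).comp_injective hσ)
  LinearMap.mkContinuous
    { toFun := fun f => (⟨fun i => f (σ i), mem f⟩ : Hil L I)
      map_add' := fun f g => rfl
      map_smul' := fun c f => rfl } 1
    (by
      intro f
      rw [one_mul]
      refine lp.norm_le_of_tsum_le (by norm_num) (norm_nonneg f) ?_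
      rw [lp.norm_rpow_eq_tsum (by norm_num) f]
      exact tsum_comp_le_tsum_of_inj ((lp.memℓp f).summable (by norm_num))
        (fun i => by positivity) hσ)

/-! ### The scattering zipper restricted to an interval -/

/-- The integers in the interval `[a,b]`, with `a, b ∈ ℤ ∪ {±∞}`. -/
def sites (a b : WithBot (WithTop ℤ)) : Set ℤ :=
  {n | a ≤ ((n : WithTop ℤ) : WithBot (WithTop ℤ)) ∧ ((n : WithTop ℤ) : WithBot (WithTop ℤ)) ≤ b}

/-- `ℤ` is cut into the pairs `{n, n+1}` with `n ≡ r` modulo `2`; `mate r i` is the other element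
of the pair of `i`. -/
def mate (r i : ℤ) : ℤ := if Even (i - r) then i + 1 else i - 1

open Classical in
/-- The mate of a site if it lies in `I`, otherwise the site itself. -/
noncomputable def mateIn (r : ℤ) {I : Set ℤ} (i : I) : I :=
  if h : mate r i ∈ I then ⟨mate r i, h⟩ else i

theorem mate_mate (r i : ℤ) : mate r (mate r i) = i := by
  unfold mate
  split_ifs with h1 h2 h2 <;> grind

theorem mateIn_injective (r : ℤ) (I : Set ℤ) : Function.Injective (mateIn r (I := I)) := by
  have h : Function.Involutive (mateIn r (I := I)) := by
    intro i
    apply Subtype.ext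
    by_cases hi : mate r i ∈ I
    · simp [mateIn, hi, mate_mate]
    · simp [mateIn, hi]
  exact h.injective

open Classical in
/-- The diagonal `L × L` blocks of the layer of parity `r`. A site `i` whose mate lies outside `I`
carries a boundary condition: `bl` if the mate is `i - 1`, `br` if it is `i + 1`. -/
noncomputable def layerDiag {L : ℕ} (α : Matrix (Fin L) (Fin L) ℂ) (bl br : UL L) (ω : Sample L)
    (r : ℤ) {I : Set ℤ} (i : I) : Matrix (Fin L) (Fin L) ℂ :=
  if mate r i ∈ I then
    if Even ((i : ℤ) - r) then α else blockD α ω (i - 1)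
  else
    if Even ((i : ℤ) - r) then (br : Matrix (Fin L) (Fin L) ℂ) else (bl : Matrix (Fin L) (Fin L) ℂ)

open Classical in
/-- The off-diagonal `L × L` blocks, in row `i` and column `mate r i`, of the layer of
parity `r`. -/
noncomputable def layerOff {L : ℕ} (α : Matrix (Fin L) (Fin L) ℂ) (ω : Sample L)
    (r : ℤ) {I : Set ℤ} (i : I) : Matrix (Fin L) (Fin L) ℂ :=
  if mate r i ∈ I then
    if Even ((i : ℤ) - r) then blockB α ω i else blockC α ω (i - 1)
  else 0

theorem norm_op_mul_unitary {L : ℕ} (A : Matrix (Fin L) (Fin L) ℂ) (u : UL L) :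
    ‖op (A * (u : Matrix (Fin L) (Fin L) ℂ))‖ = ‖op A‖ := by
  have hu : op (u : Matrix (Fin L) (Fin L) ℂ) ∈ unitary (Fib L →L[ℂ] Fib L) :=
    Unitary.map_mem (Matrix.toEuclideanCLM (n := Fin L) (𝕜 := ℂ)) u.2
  rw [op, map_mul]
  exact CStarRing.norm_mul_mem_unitary _ hu

theorem norm_op_unitary_mul {L : ℕ} (u : UL L) (A : Matrix (Fin L) (Fin L) ℂ) :
    ‖op ((u : Matrix (Fin L) (Fin L) ℂ) * A)‖ = ‖op A‖ := by
  have hu : op (u : Matrix (Fin L) (Fin L) ℂ) ∈ unitary (Fib L →L[ℂ] Fib L) :=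
    Unitary.map_mem (Matrix.toEuclideanCLM (n := Fin L) (𝕜 := ℂ)) u.2
  rw [op, map_mul]
  exact CStarRing.norm_mem_unitary_mul _ hu

theorem layerDiag_bounded {L : ℕ} (α : Matrix (Fin L) (Fin L) ℂ) (bl br : UL L) (ω : Sample L)
    (r : ℤ) (I : Set ℤ) : ∃ C, ∀ i : I, ‖op (layerDiag α bl br ω r i)‖ ≤ C := by
  refine ⟨‖op α‖ + ‖op α.conjTranspose‖ + ‖op (br : Matrix (Fin L) (Fin L) ℂ)‖
    + ‖op (bl : Matrix (Fin L) (Fin L) ℂ)‖, fun i => ?_⟩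
  have hD : ∀ n, ‖op (blockD α ω n)‖ = ‖op α.conjTranspose‖ := fun n => by
    rw [blockD, op, map_neg, norm_neg]
    exact (norm_op_mul_unitary _ _).trans (norm_op_unitary_mul _ _)
  have h1 := norm_nonneg (op α)
  have h2 := norm_nonneg (op α.conjTranspose)
  have h3 := norm_nonneg (op (br : Matrix (Fin L) (Fin L) ℂ))
  have h4 := norm_nonneg (op (bl : Matrix (Fin L) (Fin L) ℂ))
  unfold layerDiag
  split_ifs
  · linarith
  · rw [hD]; linarith
  · linarith
  · linarith

theorem layerOff_bounded {L : ℕ} (α : Matrix (Fin L) (Fin L) ℂ) (ω : Sample L)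
    (r : ℤ) (I : Set ℤ) : ∃ C, ∀ i : I, ‖op (layerOff α ω r i)‖ ≤ C := by
  refine ⟨‖op (rho α)‖ + ‖op (rhoT α)‖, fun i => ?_⟩
  have h1 := norm_nonneg (op (rho α))
  have h2 := norm_nonneg (op (rhoT α))
  unfold layerOff
  split_ifs
  · rw [blockB, norm_op_mul_unitary]; linarith
  · rw [blockC, norm_op_unitary_mul]; linarith
  · rw [op, map_zero, norm_zero]; linarith

/-- The layer of parity `r`: the direct sum of the scattering matrices `S^{(n)}_ω`, `n ≡ r`
modulo `2`, acting on the sites `(n, n+1)`, for the pairs `{n, n+1}` inside `I`, and of the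
boundary conditions on the sites of `I` whose pair is cut. -/
noncomputable def layer {L : ℕ} (α : Matrix (Fin L) (Fin L) ℂ) (bl br : UL L) (I : Set ℤ)
    (ω : Sample L) (r : ℤ) : Hil L I →L[ℂ] Hil L I :=
  diagOp (fun i => op (layerDiag α bl br ω r i)) (layerDiag_bounded α bl br ω r I) +
    diagOp (fun i => op (layerOff α ω r i)) (layerOff_bounded α ω r I) ∘L
      reindexOp (mateIn r) (mateIn_injective r I)

/-- `𝕌_ω^{[a,b]} = 𝕍_ω^{[a,b]} 𝕎_ω^{[a,b]}`, where `𝕍` carries the scattering matrices of even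
index and `𝕎` those of odd index; `bl` is the boundary condition at `a` (if `a` is finite) and `br`
the one at `b` (if `b` is finite). -/
noncomputable def zipper {L : ℕ} (α : Matrix (Fin L) (Fin L) ℂ) (bl br : UL L)
    (a b : WithBot (WithTop ℤ)) (ω : Sample L) :
    Hil L (sites a b) →L[ℂ] Hil L (sites a b) :=
  layer α bl br (sites a b) ω 0 ∘L layer α bl br (sites a b) ω 1

/-- The resolvent `(𝕌_ω^{[a,b]} - z)^{-1}`. -/
noncomputable def resolventOp {L : ℕ} (α : Matrix (Fin L) (Fin L) ℂ) (bl br : UL L)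
    (a b : WithBot (WithTop ℤ)) (ω : Sample L) (z : ℂ) :
    Hil L (sites a b) →L[ℂ] Hil L (sites a b) :=
  Ring.inverse (zipper α bl br a b ω - z • ContinuousLinearMap.id ℂ _)

open Classical in
/-- The canonical basis vector `e_{k,q}` of `ℓ²(I, ℂ^L)`. -/
noncomputable def basisVec {L : ℕ} {I : Set ℤ} (k : I) (q : Fin L) : Hil L I :=
  lp.single 2 k (EuclideanSpace.single q (1 : ℂ))

/-- The `L × L` block `G_ω^{[a,b]}(z,k,l)` of the Green kernel, with entries
`⟨e_{k,p}, (𝕌_ω^{[a,b]} - z)^{-1} e_{l,q}⟩`. -/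
noncomputable def green {L : ℕ} (α : Matrix (Fin L) (Fin L) ℂ) (bl br : UL L)
    (a b : WithBot (WithTop ℤ)) (ω : Sample L) (z : ℂ) (k l : sites a b) :
    Matrix (Fin L) (Fin L) ℂ :=
  Matrix.of fun p q => inner ℂ (basisVec k p) (resolventOp α bl br a b ω z (basisVec l q))

/-- The matrix norm subordinate to a norm `N` on `ℂ^L`. -/
noncomputable def subordinateNorm {L : ℕ} (N : Seminorm ℂ (Fin L → ℂ))
    (A : Matrix (Fin L) (Fin L) ℂ) : ℝ :=
  sSup ((fun x => N (A.mulVec x)) '' {x | N x ≤ 1})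

end ScatteringZipper

open ScatteringZipper

/-!
The operator `𝕌` is unitary, so away from the unit circle the resolvent is bounded by
`|‖z‖ - 1|⁻¹`. Near the circle, freeze everything except one angle of the phase between the sites
`k - 1` and `k` and one angle of the phase between `l - 1` and `l`. Resampling such an angle
multiplies a layer of `𝕌` by `1 + (e^{iθ} - 1)|x⟩⟨x|`, where the unit vector `x` at the site does
not depend on the angle: it is a column of the reflection `Ṽ d Ṽ^*` or `Ũ D Ũ^*`. Each of the two
layers acquires its rank-one phase on the left or on the right; a conjugation, which leaves
`|⟨x, (𝕌 - z)⁻¹ y⟩|` unchanged, puts both on the left. Then `z ⟨x, (𝕌 - z)⁻¹ y⟩` is a unimodular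
multiple of `c / P`, where `P` is bilinear in the two phases. With `W` the unitary `𝕌` at frozen
angles, one of `1 + z (W - z)⁻¹` and `-z (W - z)⁻¹` has real part at least `1/2`, which forces one
of the two extreme coefficients of `P` to dominate `c`. Hence the moments of order `s < 1` are
bounded by those of the inverse distance to a uniform point of the circle, and summing over two
bases gives the `L × L` block.

A site whose left pair is cut carries a boundary condition instead of angles. There the resolvent
equation hops to the neighbouring site at the cost of a factor `(r - ‖α‖)⁻¹`, where
`‖α‖ < r ≤ |z|`.
-/

namespace ScatteringZipper

/-! ### Scattering matrices -/

section SquareRoot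

open scoped MatrixOrder ComplexOrder Matrix.Norms.L2Operator

variable {m n : Type*} [Fintype m] [DecidableEq m] [Fintype n] [DecidableEq n]

theorem sqrt_fromBlocks_diagonal {P : Matrix m m ℂ} {Q : Matrix n n ℂ} (hP : 0 ≤ P) (hQ : 0 ≤ Q) :
    CFC.sqrt (Matrix.fromBlocks P 0 0 Q) =
      Matrix.fromBlocks (CFC.sqrt P) 0 0 (CFC.sqrt Q) := by
  refine CFC.sqrt_unique ?_ ?_
  · rw [Matrix.fromBlocks_multiply, CFC.sqrt_mul_sqrt_self P, CFC.sqrt_mul_sqrt_self Q]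
    simp
  · obtain ⟨p, hp⟩ := CStarAlgebra.nonneg_iff_eq_star_mul_self.1 (CFC.sqrt_nonneg P)
    obtain ⟨q, hq⟩ := CStarAlgebra.nonneg_iff_eq_star_mul_self.1 (CFC.sqrt_nonneg Q)
    refine CStarAlgebra.nonneg_iff_eq_star_mul_self.2 ⟨Matrix.fromBlocks p 0 0 q, ?_⟩
    rw [Matrix.star_eq_conjTranspose, Matrix.fromBlocks_conjTranspose, Matrix.fromBlocks_multiply,
      hp, hq]
    simp [Matrix.star_eq_conjTranspose]

/-- Off-diagonal block matrices turn the intertwining relation into a commutation relation. -/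
theorem sqrt_mul_eq_mul_sqrt {P : Matrix m m ℂ} {Q : Matrix n n ℂ} {X : Matrix m n ℂ}
    (hP : 0 ≤ P) (hQ : 0 ≤ Q) (h : P * X = X * Q) : CFC.sqrt P * X = X * CFC.sqrt Q := by
  have hcomm : Commute (Matrix.fromBlocks P 0 0 Q) (Matrix.fromBlocks 0 X 0 0) := by
    simp [commute_iff_eq, Matrix.fromBlocks_multiply, h]
  have hsqrt := hcomm.cfcₙ_nnreal NNReal.sqrt
  rw [← CFC.sqrt, sqrt_fromBlocks_diagonal hP hQ, commute_iff_eq, Matrix.fromBlocks_multiply,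
    Matrix.fromBlocks_multiply, Matrix.fromBlocks_inj] at hsqrt
  simpa using hsqrt.2.1

theorem one_sub_conjTranspose_mul_self_nonneg {A : Matrix n n ℂ} (hA : ‖A‖ ≤ 1) :
    0 ≤ 1 - A.conjTranspose * A :=
  sub_nonneg.2 <| (CStarAlgebra.norm_le_one_iff_of_nonneg _ (star_mul_self_nonneg A)).1 <| by
    rw [CStarRing.norm_star_mul_self]
    exact mul_le_one₀ hA (norm_nonneg A) hA

variable {L : ℕ} {α : Matrix (Fin L) (Fin L) ℂ}

theorem rhoT_eq_rho (α : Matrix (Fin L) (Fin L) ℂ) : rhoT α = rho α.conjTranspose := by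
  rw [rhoT, rho, Matrix.conjTranspose_conjTranspose]

theorem op_conjTranspose (A : Matrix (Fin L) (Fin L) ℂ) : op A.conjTranspose = star (op A) :=
  map_star (Matrix.toEuclideanCLM (n := Fin L) (𝕜 := ℂ)) A

theorem norm_op_conjTranspose (A : Matrix (Fin L) (Fin L) ℂ) : ‖op A.conjTranspose‖ = ‖op A‖ := by
  rw [op_conjTranspose]
  exact norm_star (op A)

theorem one_sub_mul_conjTranspose_nonneg (hα : ‖op α‖ ≤ 1) : 0 ≤ 1 - α * α.conjTranspose := by
  rw [← norm_op_conjTranspose, ← Matrix.cstar_norm_def] at hα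
  simpa using one_sub_conjTranspose_mul_self_nonneg hα

theorem rho_mul_rho (hα : ‖op α‖ ≤ 1) : rho α * rho α = 1 - α * α.conjTranspose :=
  CFC.sqrt_mul_sqrt_self _ (one_sub_mul_conjTranspose_nonneg hα)

theorem rhoT_mul_rhoT (hα : ‖op α‖ ≤ 1) : rhoT α * rhoT α = 1 - α.conjTranspose * α := by
  rw [rhoT_eq_rho, rho_mul_rho (by rwa [norm_op_conjTranspose]), Matrix.conjTranspose_conjTranspose]

theorem conjTranspose_rho (α : Matrix (Fin L) (Fin L) ℂ) : (rho α).conjTranspose = rho α :=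
  (CFC.sqrt_nonneg _).isSelfAdjoint.star_eq

theorem conjTranspose_rhoT (α : Matrix (Fin L) (Fin L) ℂ) : (rhoT α).conjTranspose = rhoT α := by
  rw [rhoT_eq_rho, conjTranspose_rho]

theorem rho_mul_self (hα : ‖op α‖ ≤ 1) : rho α * α = α * rhoT α :=
  sqrt_mul_eq_mul_sqrt (one_sub_mul_conjTranspose_nonneg hα)
    (one_sub_conjTranspose_mul_self_nonneg hα) (by noncomm_ring)

theorem norm_op_rho_le_one (hα : ‖op α‖ ≤ 1) : ‖op (rho α)‖ ≤ 1 := by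
  have hstar : ‖star (rho α) * rho α‖ ≤ 1 := by
    rw [Matrix.star_eq_conjTranspose, conjTranspose_rho, rho_mul_rho hα,
      CStarAlgebra.norm_le_one_iff_of_nonneg _ (one_sub_mul_conjTranspose_nonneg hα)]
    exact sub_le_self _ (mul_star_self_nonneg α)
  rw [CStarRing.norm_star_mul_self] at hstar
  exact abs_le_one_iff_mul_self_le_one.2 hstar |>.trans' (le_abs_self _)

theorem norm_op_rhoT_le_one (hα : ‖op α‖ ≤ 1) : ‖op (rhoT α)‖ ≤ 1 := by
  rw [rhoT_eq_rho]
  exact norm_op_rho_le_one (by rwa [norm_op_conjTranspose])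

end SquareRoot

section Scattering

variable {L : ℕ} {α : Matrix (Fin L) (Fin L) ℂ}

/-- The scattering matrix `S^{(n)}_ω`. -/
noncomputable def scattering (α : Matrix (Fin L) (Fin L) ℂ) (ω : Sample L) (n : ℤ) :
    Matrix (Fin L ⊕ Fin L) (Fin L ⊕ Fin L) ℂ :=
  Matrix.fromBlocks α (blockB α ω n) (blockC α ω n) (blockD α ω n)

theorem fromBlocks_rho_mem_unitaryGroup (hα : ‖op α‖ ≤ 1) :
    Matrix.fromBlocks α (rho α) (rhoT α) (-α.conjTranspose) ∈
      Matrix.unitaryGroup (Fin L ⊕ Fin L) ℂ := by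
  have hcross : α.conjTranspose * rho α = rhoT α * α.conjTranspose := by
    simpa [conjTranspose_rho, conjTranspose_rhoT] using
      congrArg Matrix.conjTranspose (rho_mul_self hα)
  rw [Matrix.mem_unitaryGroup_iff', Matrix.star_eq_conjTranspose, Matrix.fromBlocks_conjTranspose,
    Matrix.fromBlocks_multiply, ← Matrix.fromBlocks_one]
  simp [conjTranspose_rho, conjTranspose_rhoT, rho_mul_rho hα, rhoT_mul_rhoT hα, rho_mul_self hα,
    hcross]

theorem fromBlocks_diagonal_mem_unitaryGroup (u v : UL L) :
    Matrix.fromBlocks (u : Matrix (Fin L) (Fin L) ℂ) 0 0 v ∈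
      Matrix.unitaryGroup (Fin L ⊕ Fin L) ℂ := by
  rw [Matrix.mem_unitaryGroup_iff', Matrix.star_eq_conjTranspose, Matrix.fromBlocks_conjTranspose,
    Matrix.fromBlocks_multiply, ← Matrix.fromBlocks_one]
  simp [← Matrix.star_eq_conjTranspose]

theorem scattering_mem_unitaryGroup (hα : ‖op α‖ ≤ 1) (ω : Sample L) (n : ℤ) :
    scattering α ω n ∈ Matrix.unitaryGroup (Fin L ⊕ Fin L) ℂ := by
  have hfactor : scattering α ω n =
      Matrix.fromBlocks ((1 : UL L) : Matrix (Fin L) (Fin L) ℂ) 0 0 (Vph ω n) *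
        Matrix.fromBlocks α (rho α) (rhoT α) (-α.conjTranspose) *
        Matrix.fromBlocks ((1 : UL L) : Matrix (Fin L) (Fin L) ℂ) 0 0 (Uph ω n) := by
    simp [scattering, blockB, blockC, blockD, Matrix.fromBlocks_multiply]
  rw [hfactor]
  exact mul_mem (mul_mem (fromBlocks_diagonal_mem_unitaryGroup _ _)
    (fromBlocks_rho_mem_unitaryGroup hα)) (fromBlocks_diagonal_mem_unitaryGroup _ _)

end Scattering

/-! ### The layers -/

section Layers

variable {L : ℕ} {I : Set ℤ} {r : ℤ} {i : I}

theorem mateIn_involutive (r : ℤ) : Function.Involutive (mateIn r (I := I)) := by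
  intro i
  apply Subtype.ext
  by_cases hi : mate r i ∈ I
  · simp [mateIn, hi, mate_mate]
  · simp [mateIn, hi]

theorem mate_of_even {j : ℤ} (h : Even (j - r)) : mate r j = j + 1 := if_pos h

theorem mate_of_not_even {j : ℤ} (h : ¬Even (j - r)) : mate r j = j - 1 := if_neg h

theorem not_even_mate_sub {j : ℤ} : ¬Even (mate r j - r) ↔ Even (j - r) := by
  unfold mate
  split_ifs <;> grind

theorem mateIn_of_mem (hi : mate r i ∈ I) : mateIn r i = ⟨mate r i, hi⟩ := dif_pos hi

theorem coe_mateIn_of_even (hi : mate r i ∈ I) (h : Even ((i : ℤ) - r)) :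
    (mateIn r i : ℤ) = i + 1 := by
  rw [mateIn_of_mem hi]
  exact mate_of_even h

theorem mateIn_of_notMem (hi : mate r i ∉ I) : mateIn r i = i := dif_neg hi

variable {α : Matrix (Fin L) (Fin L) ℂ} {bl br : UL L} {ω : Sample L}

theorem layerDiag_of_even (hi : mate r i ∈ I) (h : Even ((i : ℤ) - r)) :
    layerDiag α bl br ω r i = α := by
  simp only [layerDiag, if_pos hi, if_pos h]

theorem layerDiag_of_not_even (hi : mate r i ∈ I) (h : ¬Even ((i : ℤ) - r)) :
    layerDiag α bl br ω r i = blockD α ω (i - 1) := by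
  simp only [layerDiag, if_pos hi, if_neg h]

theorem exists_layerDiag_eq_of_notMem (hi : mate r i ∉ I) :
    ∃ u : UL L, layerDiag α bl br ω r i = u := by
  simp only [layerDiag, if_neg hi]
  split_ifs
  exacts [⟨br, rfl⟩, ⟨bl, rfl⟩]

theorem layerOff_of_even (hi : mate r i ∈ I) (h : Even ((i : ℤ) - r)) :
    layerOff α ω r i = blockB α ω i := by
  simp only [layerOff, if_pos hi, if_pos h]

theorem layerOff_of_not_even (hi : mate r i ∈ I) (h : ¬Even ((i : ℤ) - r)) :
    layerOff α ω r i = blockC α ω (i - 1) := by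
  simp only [layerOff, if_pos hi, if_neg h]

theorem layerOff_of_notMem (hi : mate r i ∉ I) : layerOff α ω r i = 0 := if_neg hi

/-- The action of the layer of parity `r` on the pair formed by `i` and its mate, with the site `i`
first; both sites are `i` when the mate is outside `I`. -/
noncomputable def pairBlock (α : Matrix (Fin L) (Fin L) ℂ) (bl br : UL L) (ω : Sample L) (r : ℤ)
    (i : I) : Matrix (Fin L ⊕ Fin L) (Fin L ⊕ Fin L) ℂ :=
  Matrix.fromBlocks (layerDiag α bl br ω r i) (layerOff α ω r i)
    (layerOff α ω r (mateIn r i)) (layerDiag α bl br ω r (mateIn r i))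

theorem pairBlock_of_even (hi : mate r i ∈ I) (h : Even ((i : ℤ) - r)) :
    pairBlock α bl br ω r i = scattering α ω i := by
  have hm : mate r (mateIn r i) ∈ I := by rw [mateIn_of_mem hi, mate_mate]; exact i.2
  have hodd : ¬Even ((mateIn r i : ℤ) - r) := by rwa [mateIn_of_mem hi, not_even_mate_sub]
  rw [pairBlock, scattering, layerDiag_of_even hi h, layerOff_of_even hi h,
    layerDiag_of_not_even hm hodd, layerOff_of_not_even hm hodd,
    coe_mateIn_of_even hi h, add_sub_cancel_right]

theorem pairBlock_mateIn (α : Matrix (Fin L) (Fin L) ℂ) (bl br : UL L) (ω : Sample L) (r : ℤ)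
    (i : I) :
    pairBlock α bl br ω r (mateIn r i) = (pairBlock α bl br ω r i).submatrix Sum.swap Sum.swap := by
  rw [pairBlock, pairBlock, Matrix.fromBlocks_submatrix_sum_swap_sum_swap, mateIn_involutive r i]

theorem submatrix_mem_unitaryGroup {m n : Type*} [Fintype m] [DecidableEq m] [Fintype n]
    [DecidableEq n] {A : Matrix n n ℂ} (hA : A ∈ Matrix.unitaryGroup n ℂ) (e : m ≃ n) :
    A.submatrix e e ∈ Matrix.unitaryGroup m ℂ := by
  rw [Matrix.mem_unitaryGroup_iff, Matrix.star_eq_conjTranspose] at hA ⊢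
  rw [Matrix.conjTranspose_submatrix, Matrix.submatrix_mul_equiv, hA, Matrix.submatrix_one_equiv]

theorem pairBlock_mem_unitaryGroup (hα : ‖op α‖ ≤ 1) (bl br : UL L) (ω : Sample L) (r : ℤ)
    (i : I) : pairBlock α bl br ω r i ∈ Matrix.unitaryGroup (Fin L ⊕ Fin L) ℂ := by
  by_cases hi : mate r i ∈ I
  · by_cases h : Even ((i : ℤ) - r)
    · rw [pairBlock_of_even hi h]
      exact scattering_mem_unitaryGroup hα ω i
    · have hm : mate r (mateIn r i) ∈ I := by rw [mateIn_of_mem hi, mate_mate]; exact i.2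
      have heven : Even ((mateIn r i : ℤ) - r) := by
        rwa [mateIn_of_mem hi, ← not_not (a := Even _), not_even_mate_sub]
      rw [← mateIn_involutive r i, pairBlock_mateIn, pairBlock_of_even hm heven]
      exact submatrix_mem_unitaryGroup (scattering_mem_unitaryGroup hα ω _) (Equiv.sumComm _ _)
  · obtain ⟨u, hu⟩ := exists_layerDiag_eq_of_notMem (α := α) (bl := bl) (br := br) (ω := ω) hi
    rw [pairBlock, mateIn_of_notMem hi, hu, layerOff_of_notMem hi]
    exact fromBlocks_diagonal_mem_unitaryGroup u u

theorem diagOp_apply (A : I → Fib L →L[ℂ] Fib L) (hA : ∃ C, ∀ i, ‖A i‖ ≤ C) (f : Hil L I) (i : I) :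
    diagOp A hA f i = A i (f i) := rfl

theorem reindexOp_apply (σ : I → I) (hσ : Function.Injective σ) (f : Hil L I) (i : I) :
    reindexOp σ hσ f i = f (σ i) := rfl

theorem star_diagOp (A : I → Fib L →L[ℂ] Fib L) (hA : ∃ C, ∀ i, ‖A i‖ ≤ C)
    (hA' : ∃ C, ∀ i, ‖star (A i)‖ ≤ C) :
    star (diagOp A hA) = diagOp (fun i => star (A i)) hA' := by
  symm
  rw [ContinuousLinearMap.star_eq_adjoint, ContinuousLinearMap.eq_adjoint_iff]
  intro f g
  rw [lp.inner_eq_tsum, lp.inner_eq_tsum]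
  refine tsum_congr fun i => ?_
  rw [diagOp_apply, diagOp_apply, ContinuousLinearMap.star_eq_adjoint,
    ContinuousLinearMap.adjoint_inner_left]

theorem star_reindexOp (σ : I → I) (hσ : Function.Involutive σ) :
    star (reindexOp (L := L) σ hσ.injective) = reindexOp σ hσ.injective := by
  symm
  rw [ContinuousLinearMap.star_eq_adjoint, ContinuousLinearMap.eq_adjoint_iff]
  intro f g
  rw [lp.inner_eq_tsum, lp.inner_eq_tsum, ← (hσ.toPerm σ).tsum_eq]
  refine tsum_congr fun i => ?_
  rw [reindexOp_apply, reindexOp_apply, Function.Involutive.coe_toPerm, hσ i]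

theorem layer_apply (α : Matrix (Fin L) (Fin L) ℂ) (bl br : UL L) (ω : Sample L) (r : ℤ)
    (f : Hil L I) (i : I) :
    layer α bl br I ω r f i =
      op (layerDiag α bl br ω r i) (f i) + op (layerOff α ω r i) (f (mateIn r i)) := rfl

theorem star_layer_apply (α : Matrix (Fin L) (Fin L) ℂ) (bl br : UL L) (ω : Sample L) (r : ℤ)
    (f : Hil L I) (i : I) :
    star (layer α bl br I ω r) f i =
      op (layerDiag α bl br ω r i).conjTranspose (f i) +
        op (layerOff α ω r (mateIn r i)).conjTranspose (f (mateIn r i)) := by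
  have hstar : ∀ A : I → Fib L →L[ℂ] Fib L, (∃ C, ∀ i, ‖A i‖ ≤ C) →
      ∃ C, ∀ i, ‖star (A i)‖ ≤ C := fun A ⟨C, hC⟩ => ⟨C, fun i => (norm_star (A i)).trans_le (hC i)⟩
  have hcomp (A B : Hil L I →L[ℂ] Hil L I) : star (A ∘L B) = star B ∘L star A := star_mul A B
  rw [layer, star_add, hcomp, star_diagOp _ _ (hstar _ (layerDiag_bounded α bl br ω r I)),
    star_diagOp _ _ (hstar _ (layerOff_bounded α ω r I)),
    star_reindexOp _ (mateIn_involutive r), op_conjTranspose, op_conjTranspose]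
  rfl

theorem op_mul_apply (A B : Matrix (Fin L) (Fin L) ℂ) (v : Fib L) :
    op (A * B) v = op A (op B v) := by
  rw [op, map_mul]; rfl

theorem op_mul_apply_add (A B C D : Matrix (Fin L) (Fin L) ℂ) (v : Fib L) :
    op A (op B v) + op C (op D v) = op (A * B + C * D) v := by
  rw [op, op, op, op, op, map_add, map_mul, map_mul]; rfl

theorem layer_mem_unitary (hα : ‖op α‖ ≤ 1) (bl br : UL L) (I : Set ℤ) (ω : Sample L) (r : ℤ) :
    layer α bl br I ω r ∈ unitary (Hil L I →L[ℂ] Hil L I) := by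
  have hunit := pairBlock_mem_unitaryGroup (I := I) hα bl br ω r
  refine Unitary.mem_iff.2 ⟨?_, ?_⟩ <;> ext1 f <;> ext1 <;> funext i
  · have h := Matrix.mem_unitaryGroup_iff'.1 (hunit i)
    rw [Matrix.star_eq_conjTranspose, pairBlock, Matrix.fromBlocks_conjTranspose,
      Matrix.fromBlocks_multiply, ← Matrix.fromBlocks_one, Matrix.fromBlocks_inj] at h
    change star (layer α bl br I ω r) (layer α bl br I ω r f) i = f i
    rw [star_layer_apply, layer_apply, layer_apply, mateIn_involutive, map_add, map_add,
      add_comm (op (layerOff α ω r (mateIn r i)).conjTranspose _), add_add_add_comm,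
      op_mul_apply_add, op_mul_apply_add, h.1, h.2.1]
    simp [op]
  · have h := Matrix.mem_unitaryGroup_iff.1 (hunit i)
    rw [Matrix.star_eq_conjTranspose, pairBlock, Matrix.fromBlocks_conjTranspose,
      Matrix.fromBlocks_multiply, ← Matrix.fromBlocks_one, Matrix.fromBlocks_inj] at h
    change layer α bl br I ω r (star (layer α bl br I ω r) f) i = f i
    rw [layer_apply, star_layer_apply, star_layer_apply, mateIn_involutive, map_add, map_add,
      add_comm (op (layerOff α ω r i) _), add_add_add_comm,
      op_mul_apply_add, op_mul_apply_add, h.1, h.2.1]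
    simp [op]

theorem zipper_mem_unitary (hα : ‖op α‖ ≤ 1) (bl br : UL L) (a b : WithBot (WithTop ℤ))
    (ω : Sample L) :
    zipper α bl br a b ω ∈ unitary (Hil L (sites a b) →L[ℂ] Hil L (sites a b)) :=
  mul_mem (layer_mem_unitary hα bl br _ ω 0) (layer_mem_unitary hα bl br _ ω 1)

theorem isUnit_sub_smul_id_of_mem_unitary {E : Type*} [NormedAddCommGroup E]
    [InnerProductSpace ℂ E] [CompleteSpace E] {W : E →L[ℂ] E} (hW : W ∈ unitary (E →L[ℂ] E)) {z : ℂ}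
    (hz : ‖z‖ ≠ 1) : IsUnit (W - z • ContinuousLinearMap.id ℂ E) := by
  have hspec : z ∉ spectrum ℂ W := fun hmem =>
    hz (mem_sphere_zero_iff_norm.1 (spectrum.subset_circle_of_unitary hW hmem))
  rwa [spectrum.notMem_iff, IsUnit.sub_iff, Algebra.algebraMap_eq_smul_one] at hspec

end Layers

/-! ### Rank-one phases -/

section LinePhase

variable {H : Type*} [NormedAddCommGroup H] [InnerProductSpace ℂ H] {x y : H}

/-- The operator multiplying by `u` on the line spanned by the unit vector `x` and acting trivially
on its orthogonal complement. -/
noncomputable def linePhase (x : H) (u : ℂ) : H →L[ℂ] H :=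
  1 + (u - 1) • (innerSL ℂ x).smulRight x

theorem linePhase_apply (x : H) (u : ℂ) (ψ : H) :
    linePhase x u ψ = ψ + ((u - 1) * inner ℂ x ψ) • x := by
  simp [linePhase, mul_smul]

theorem linePhase_one (x ψ : H) : linePhase x 1 ψ = ψ := by simp [linePhase_apply]

theorem inner_linePhase (hx : ‖x‖ = 1) (u : ℂ) (ψ : H) :
    inner ℂ x (linePhase x u ψ) = u * inner ℂ x ψ := by
  rw [linePhase_apply, inner_add_right, inner_smul_right, inner_self_eq_norm_sq_to_K, hx]
  push_cast
  ring

theorem inner_linePhase_of_orthogonal (h : inner ℂ y x = (0 : ℂ)) (u : ℂ) (ψ : H) :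
    inner ℂ y (linePhase x u ψ) = inner ℂ y ψ := by
  rw [linePhase_apply, inner_add_right, inner_smul_right, h, mul_zero, add_zero]

theorem linePhase_linePhase (hx : ‖x‖ = 1) (u v : ℂ) (ψ : H) :
    linePhase x u (linePhase x v ψ) = linePhase x (u * v) ψ := by
  rw [linePhase_apply x u, inner_linePhase hx, linePhase_apply, linePhase_apply]
  module

theorem linePhase_comm (h : inner ℂ x y = (0 : ℂ)) (u v : ℂ) (ψ : H) :
    linePhase x u (linePhase y v ψ) = linePhase y v (linePhase x u ψ) := by
  rw [linePhase_apply x u, inner_linePhase_of_orthogonal h, linePhase_apply y v (linePhase x u ψ),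
    inner_linePhase_of_orthogonal (inner_eq_zero_symm.1 h), linePhase_apply, linePhase_apply]
  module

theorem linePhase_self (hx : ‖x‖ = 1) (u : ℂ) : linePhase x u x = u • x := by
  rw [linePhase_apply, inner_self_eq_norm_sq_to_K, hx]
  push_cast
  module

theorem linePhase_of_orthogonal (h : inner ℂ x y = (0 : ℂ)) (u : ℂ) : linePhase x u y = y := by
  rw [linePhase_apply, h, mul_zero, zero_smul, add_zero]

/-- Conjugating by the phases on the right moves them to the left. -/
theorem exists_linePhase_left {W : H →L[ℂ] H} (hx : ‖x‖ = 1) (hy : ‖y‖ = 1)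
    (hxy : inner ℂ x y = (0 : ℂ)) {z u₁ u₂ v₁ v₂ : ℂ} (hu : ‖u₂‖ = 1) (hv : ‖v₂‖ = 1) {ψ : H}
    (h : linePhase x u₁ (linePhase y v₁ (W (linePhase y v₂ (linePhase x u₂ ψ)))) - z • ψ = y) :
    ∃ φ : H, linePhase x (u₁ * u₂) (linePhase y (v₁ * v₂) (W φ)) - z • φ = y ∧
      ‖(inner ℂ x φ : ℂ)‖ = ‖(inner ℂ x ψ : ℂ)‖ := by
  have hv0 : v₂ ≠ 0 := norm_pos_iff.1 (hv ▸ one_pos)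
  refine ⟨v₂⁻¹ • linePhase y v₂ (linePhase x u₂ ψ), ?_, ?_⟩
  · have hconj := congrArg (fun φ => v₂⁻¹ • linePhase y v₂ (linePhase x u₂ φ)) h
    simp only [map_sub, map_smul, smul_sub] at hconj
    rw [linePhase_linePhase hx, ← linePhase_comm hxy, linePhase_linePhase hy,
      linePhase_of_orthogonal hxy, linePhase_self hy, smul_smul v₂⁻¹ v₂, inv_mul_cancel₀ hv0,
      one_smul, mul_comm u₂, mul_comm v₂, smul_comm v₂⁻¹ z] at hconj
    simpa only [map_smul] using hconj
  · rw [inner_smul_right, inner_linePhase_of_orthogonal hxy, inner_linePhase hx, norm_mul, norm_mul,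
      norm_inv, hu, hv, inv_one, one_mul, one_mul]

theorem sub_smul_of_linePhase_eq {W : H →L[ℂ] H} (hx : ‖x‖ = 1) (hy : ‖y‖ = 1)
    (hxy : inner ℂ x y = (0 : ℂ)) {z u v : ℂ} (hu : u ≠ 0) (hv : v ≠ 0) {ψ : H}
    (h : linePhase x u (linePhase y v (W ψ)) - z • ψ = y) :
    W ψ - z • ψ = v⁻¹ • y + (z * (u⁻¹ - 1) * inner ℂ x ψ) • x +
      (z * (v⁻¹ - 1) * inner ℂ y ψ) • y := by
  have hinv := congrArg (fun φ => linePhase x u⁻¹ (linePhase y v⁻¹ φ)) h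
  simp only [map_sub, map_smul] at hinv
  rw [← linePhase_comm hxy u, linePhase_linePhase hx, linePhase_linePhase hy, inv_mul_cancel₀ hu,
    inv_mul_cancel₀ hv, linePhase_one, linePhase_one, linePhase_self hy, map_smul,
    linePhase_of_orthogonal hxy, linePhase_apply x, inner_linePhase_of_orthogonal hxy,
    linePhase_apply y] at hinv
  rw [← hinv]
  module

theorem inner_leftInverse_of_linePhase_eq {W R : H →L[ℂ] H} (hx : ‖x‖ = 1) (hy : ‖y‖ = 1)
    (hxy : inner ℂ x y = (0 : ℂ)) {z u v : ℂ} (hR : ∀ f, R (W f - z • f) = f) (hu : u ≠ 0)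
    (hv : v ≠ 0) {ψ : H} (h : linePhase x u (linePhase y v (W ψ)) - z • ψ = y) (w : H) :
    u * inner ℂ w (R y) + z * (1 - u) * v * inner ℂ x ψ * inner ℂ w (R x) +
      z * u * (1 - v) * inner ℂ y ψ * inner ℂ w (R y) = u * v * inner ℂ w ψ := by
  have hsol := hR ψ
  rw [sub_smul_of_linePhase_eq hx hy hxy hu hv h, map_add, map_add, map_smul, map_smul,
    map_smul] at hsol
  have hinner := congrArg (inner ℂ w) hsol
  simp only [inner_add_right, inner_smul_right] at hinner
  field_simp at hinner
  linear_combination hinner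

end LinePhase

section Accretive

variable {H : Type*} [NormedAddCommGroup H] [InnerProductSpace ℂ H]

theorem norm_sub_sq_le_two_mul_re_inner {f g : H} (h : ‖g‖ ≤ ‖f‖) :
    ‖f - g‖ ^ 2 ≤ 2 * (inner ℂ (f - g) f : ℂ).re := by
  have hsub := norm_sub_sq (𝕜 := ℂ) f g
  have hre : (inner ℂ (f - g) f : ℂ).re = ‖f‖ ^ 2 - (inner ℂ f g : ℂ).re := by
    rw [inner_sub_left, Complex.sub_re, ← inner_conj_symm g f, Complex.conj_re]
    exact congrArg (· - _) (inner_self_eq_norm_sq (𝕜 := ℂ) f)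
  simp only [RCLike.re_eq_complex_re] at hsub
  nlinarith [norm_nonneg g, norm_nonneg f]

/-- Test the form on the adjugate column `-⟨x, T y⟩ x + ⟨x, T x⟩ y`. -/
theorem det_ne_zero_and_norm_inner_le_norm_det {T : H →L[ℂ] H}
    (hT : ∀ f, ‖f‖ ^ 2 ≤ 2 * (inner ℂ f (T f) : ℂ).re) {x y : H} (hx : ‖x‖ = 1) (hy : ‖y‖ = 1)
    (hxy : inner ℂ x y = (0 : ℂ)) :
    inner ℂ x (T x) * inner ℂ y (T y) - inner ℂ x (T y) * inner ℂ y (T x) ≠ (0 : ℂ) ∧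
      ‖(inner ℂ x (T y) : ℂ)‖ ≤ ‖(inner ℂ x (T x) : ℂ) * inner ℂ y (T y) -
        inner ℂ x (T y) * inner ℂ y (T x)‖ := by
  set a : ℂ := inner ℂ x (T x)
  set b : ℂ := inner ℂ x (T y)
  set D : ℂ := a * inner ℂ y (T y) - b * inner ℂ y (T x) with hD
  have hnorm : ‖-b • x + a • y‖ ^ 2 = ‖a‖ ^ 2 + ‖b‖ ^ 2 := by
    rw [norm_add_sq (𝕜 := ℂ), inner_smul_left, inner_smul_right, hxy]
    simp only [norm_smul, norm_neg, hx, hy, mul_zero, map_zero]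
    ring
  have hinner : inner ℂ (-b • x + a • y) (T (-b • x + a • y)) = (starRingEnd ℂ) a * D := by
    simp only [map_add, map_smul, inner_add_left, inner_add_right, inner_smul_left,
      inner_smul_right, map_neg, hD]
    ring
  have hle : ‖a‖ ^ 2 + ‖b‖ ^ 2 ≤ 2 * (‖a‖ * ‖D‖) := by
    have htest := hT (-b • x + a • y)
    rw [hnorm, hinner] at htest
    have hre := Complex.re_le_norm ((starRingEnd ℂ) a * D)
    rw [norm_mul, RCLike.norm_conj] at hre
    linarith
  refine ⟨fun hD0 => ?_,
    abs_le_of_sq_le_sq' (by nlinarith [sq_nonneg (‖a‖ - ‖D‖)]) (norm_nonneg D) |>.2⟩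
  rw [hD0, norm_zero, mul_zero, mul_zero] at hle
  have ha : a = 0 := norm_eq_zero.1 (by nlinarith [sq_nonneg ‖a‖, sq_nonneg ‖b‖])
  have hx1 := hT x
  rw [hx, show inner ℂ x (T x) = (0 : ℂ) from ha, Complex.zero_re] at hx1
  norm_num at hx1

variable [CompleteSpace H]

theorem norm_sq_le_or_norm_sq_le_of_resolvent {W R : H →L[ℂ] H} (hW : W ∈ unitary (H →L[ℂ] H))
    {z : ℂ} (hR : ∀ f, W (R f) - z • R f = f) :
    (∀ f, ‖f‖ ^ 2 ≤ 2 * (inner ℂ f (f + z • R f) : ℂ).re) ∨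
      ∀ f, ‖f‖ ^ 2 ≤ 2 * (inner ℂ f (-(z • R f)) : ℂ).re := by
  have hnorm (f : H) : ‖W f‖ = ‖f‖ := ContinuousLinearMap.norm_map_of_mem_unitary hW f
  rcases le_total ‖z‖ 1 with hz | hz
  · refine Or.inl fun f => ?_
    have hle : ‖z • R f‖ ≤ ‖W (R f)‖ := by
      rw [hnorm, norm_smul]
      exact mul_le_of_le_one_left (norm_nonneg _) hz
    have hsum : f + z • R f = W (R f) := (eq_add_of_sub_eq (hR f)).symm
    simpa only [hR f, hsum] using norm_sub_sq_le_two_mul_re_inner hle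
  · refine Or.inr fun f => ?_
    have hle : ‖-W (R f)‖ ≤ ‖-(z • R f)‖ := by
      rw [norm_neg, norm_neg, hnorm, norm_smul]
      exact le_mul_of_one_le_left (norm_nonneg _) hz
    have hsub : -(z • R f) - -W (R f) = f := by rw [neg_sub_neg, hR f]
    simpa only [hsub] using norm_sub_sq_le_two_mul_re_inner hle

/-- With `p` the compression of `z (W - z)⁻¹` to the span of `x` and `y`, the denominator has
constant coefficient `det p` and leading coefficient `det (1 + p)`; the real part of `1 + p` or of
`-p` is at least `1/2` according to the side of the unit circle on which `z` lies. -/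
theorem exists_inner_mul_bilinear_eq {W : H →L[ℂ] H} (hW : W ∈ unitary (H →L[ℂ] H)) {x y : H}
    (hx : ‖x‖ = 1) (hy : ‖y‖ = 1) (hxy : inner ℂ x y = (0 : ℂ)) {z : ℂ} (hz : ‖z‖ ≠ 1) :
    ∃ c a₀₀ a₁₀ a₀₁ a₁₁ : ℂ, (a₀₀ ≠ 0 ∧ ‖c‖ ≤ ‖a₀₀‖ ∨ a₁₁ ≠ 0 ∧ ‖c‖ ≤ ‖a₁₁‖) ∧
      ∀ u v : ℂ, u ≠ 0 → v ≠ 0 → ∀ ψ : H, linePhase x u (linePhase y v (W ψ)) - z • ψ = y →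
        z * inner ℂ x ψ * (a₀₀ + a₁₀ * u + a₀₁ * v + a₁₁ * u * v) = u * c := by
  obtain ⟨R, hR, hR'⟩ := isUnit_iff_exists.1 (isUnit_sub_smul_id_of_mem_unitary hW hz)
  have hyx : inner ℂ y x = (0 : ℂ) := inner_eq_zero_symm.1 hxy
  have hself {w : H} (hw : ‖w‖ = 1) : inner ℂ w w = (1 : ℂ) := by
    simp [inner_self_eq_norm_sq_to_K, hw]
  have hacc := norm_sq_le_or_norm_sq_le_of_resolvent hW (R := R) fun f => congrArg (· f) hR
  set p : H → H → ℂ := fun w w' => z * inner ℂ w (R w')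
  refine ⟨p x y, p x x * p y y - p x y * p y x, -((1 + p x x) * p y y - p x y * p y x),
    -((1 + p y y) * p x x - p x y * p y x), (1 + p x x) * (1 + p y y) - p x y * p y x, ?_, ?_⟩
  · rcases hacc with h | h
    · have hdet := det_ne_zero_and_norm_inner_le_norm_det (T := 1 + z • R) h hx hy hxy
      simp only [add_apply, smul_apply, one_apply_eq_self, inner_add_right, inner_smul_right,
        hself hx, hself hy, hxy, hyx, zero_add] at hdet
      exact Or.inr hdet
    · have hdet := det_ne_zero_and_norm_inner_le_norm_det (T := -(z • R)) h hx hy hxy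
      simp only [neg_apply, smul_apply, inner_neg_right, inner_smul_right, neg_mul_neg,
        norm_neg] at hdet
      exact Or.inl hdet
  · intro u v hu hv ψ hψ
    have solve := inner_leftInverse_of_linePhase_eq hx hy hxy (fun f => congrArg (· f) hR') hu hv hψ
    refine mul_left_cancel₀ hv ?_
    linear_combination -z * (v - z * (1 - v) * inner ℂ y (R y)) * solve x -
      z ^ 2 * (1 - v) * inner ℂ x (R y) * solve y

end Accretive

/-! ### Fractional moments on the circle -/

section Circle

open scoped ENNReal Real

open Complex (I exp)

theorem enorm_rpow_neg_le_of_norm_le {E F : Type*} [SeminormedAddGroup E] [SeminormedAddGroup F]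
    {s : ℝ} (hs : 0 ≤ s) {a : E} {b : F} (h : ‖a‖ ≤ ‖b‖) : ‖b‖ₑ ^ (-s) ≤ ‖a‖ₑ ^ (-s) := by
  rw [ENNReal.rpow_neg, ENNReal.rpow_neg]
  gcongr
  exact enorm_le_iff_norm_le.2 h

theorem setLIntegral_abs_sin_rpow_lt_top {s : ℝ} (hs0 : 0 ≤ s) (hs1 : s < 1) :
    ∫⁻ t in Set.Ioc (-(π / 2)) (π / 2), ‖Real.sin t‖ₑ ^ (-s) < ∞ := by
  have integrableOn_rpow :
      IntegrableOn (fun t => |Real.sin t| ^ (-s)) (Metric.ball 0 (π / 2)) := by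
    refine integrableOn_ball_of_norm_le_rpow (C := (2 / π) ^ (-s)) (α := s) (by simp)
      (by simpa using hs1) ?_
      (Real.continuous_sin.abs.measurable.pow_const _).aestronglyMeasurable
    filter_upwards [ae_restrict_mem measurableSet_ball,
      ae_restrict_of_ae (Measure.ae_ne volume (0 : ℝ))] with t ht ht0
    have jordan := Real.mul_abs_le_abs_sin (mem_ball_zero_iff.1 ht).le
    rw [Real.norm_of_nonneg (by positivity), ← Real.mul_rpow (by positivity) (norm_nonneg t)]
    exact Real.rpow_le_rpow_of_nonpos (by positivity) jordan (neg_nonpos.2 hs0)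
  rw [← setLIntegral_congr Ioo_ae_eq_Ioc]
  rw [Real.ball_eq_Ioo, zero_sub, zero_add] at integrableOn_rpow
  refine lt_of_eq_of_lt (setLIntegral_congr_fun_ae measurableSet_Ioo ?_)
    integrableOn_rpow.lintegral_lt_top
  filter_upwards [Measure.ae_ne volume (0 : ℝ)] with t ht0 ht
  have sin_ne_zero : Real.sin t ≠ 0 := by
    rw [ne_eq, Real.sin_eq_zero_iff_of_lt_of_lt (by linarith [ht.1, Real.pi_pos])
      (by linarith [ht.2, Real.pi_pos])]
    exact ht0
  rw [← ofReal_norm, ENNReal.ofReal_rpow_of_pos (norm_pos_iff.2 sin_ne_zero), Real.norm_eq_abs]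

theorem setLIntegral_Ioc_add_eq_of_periodic {f : ℝ → ℝ≥0∞} {T : ℝ} (hf : Function.Periodic f T)
    (hT : 0 < T) (a b : ℝ) :
    ∫⁻ t in Set.Ioc a (a + T), f t = ∫⁻ t in Set.Ioc b (b + T), f t :=
  (isAddFundamentalDomain_Ioc hT a).setLIntegral_eq (isAddFundamentalDomain_Ioc hT b) f
    hf.map_vadd_zmultiples

theorem setLIntegral_abs_sin_sub_rpow (s φ : ℝ) :
    ∫⁻ t in Set.Icc 0 (2 * π), ‖Real.sin (t - φ)‖ₑ ^ (-s)
      = 2 * ∫⁻ t in Set.Ioc (-(π / 2)) (π / 2), ‖Real.sin t‖ₑ ^ (-s) := by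
  set f : ℝ → ℝ≥0∞ := fun t => ‖Real.sin t‖ₑ ^ (-s)
  have periodic : Function.Periodic f π := fun t => by simp only [f, Real.sin_add_pi, enorm_neg]
  have period_eq (a : ℝ) : ∫⁻ t in Set.Ioc a (a + π), f (t - φ)
      = ∫⁻ t in Set.Ioc (-(π / 2)) (π / 2), f t := by
    have translation := measurePreserving_sub_right (volume : Measure ℝ) φ
    have shift := translation.setLIntegral_comp_preimage_emb (measurableEmbedding_subRight φ) f
      (Set.Ioc (a - φ) (a - φ + π))
    rw [Set.preimage_sub_const_Ioc, sub_add_cancel, add_right_comm, sub_add_cancel] at shift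
    rw [shift, setLIntegral_Ioc_add_eq_of_periodic periodic Real.pi_pos _ (-(π / 2))]
    ring_nf
  calc ∫⁻ t in Set.Icc 0 (2 * π), f (t - φ)
      = ∫⁻ t in Set.Ioc 0 (0 + π) ∪ Set.Ioc π (π + π), f (t - φ) := by
        rw [zero_add, Set.Ioc_union_Ioc_eq_Ioc Real.pi_pos.le (by linarith [Real.pi_pos]),
          ← two_mul, setLIntegral_congr Ioc_ae_eq_Icc]
    _ = 2 * ∫⁻ t in Set.Ioc (-(π / 2)) (π / 2), f t := by
        rw [lintegral_union measurableSet_Ioc (by simp), period_eq, period_eq, two_mul]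

theorem abs_sin_sub_arg_le_norm_add_exp (c : ℂ) (θ : ℝ) :
    |Real.sin (θ - c.arg)| ≤ ‖c + exp (θ * I)‖ := by
  have rotate : (c + exp (θ * I)) * exp ((-c.arg : ℝ) * I)
      = ‖c‖ + exp ((θ - c.arg : ℝ) * I) := by
    have polar := Complex.norm_mul_exp_arg_mul_I c
    have inverse : exp (c.arg * I) * exp (-c.arg * I) = 1 := by simp [← Complex.exp_add]
    have angle : exp (θ * I) * exp (-c.arg * I) = exp ((θ - c.arg) * I) := by
      rw [← Complex.exp_add]; ring_nf
    push_cast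
    linear_combination (-exp (-c.arg * I)) * polar + (‖c‖ : ℂ) * inverse + angle
  calc |Real.sin (θ - c.arg)|
      = |((c + exp (θ * I)) * exp ((-c.arg : ℝ) * I)).im| := by
        rw [rotate, Complex.add_im, Complex.ofReal_im, zero_add, Complex.exp_ofReal_mul_I_im]
    _ ≤ ‖(c + exp (θ * I)) * exp ((-c.arg : ℝ) * I)‖ := Complex.abs_im_le_norm _
    _ = ‖c + exp (θ * I)‖ := by rw [norm_mul, Complex.norm_exp_ofReal_mul_I, mul_one]

theorem lintegral_uniformAngle (f : ℝ → ℝ≥0∞) :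
    ∫⁻ θ, f θ ∂uniformAngle
      = (ENNReal.ofReal (2 * π))⁻¹ * ∫⁻ t in Set.Icc 0 (2 * π), f t := by
  rw [uniformAngle, lintegral_smul_measure, lintegral_subtype_comap measurableSet_Icc, smul_eq_mul]

/-- The point `e^{iθ}` of the unit circle. -/
noncomputable def phase (θ : Set.Icc (0 : ℝ) (2 * π)) : ℂ :=
  exp ((θ : ℝ) * I)

@[fun_prop]
theorem continuous_phase : Continuous phase := by
  unfold phase
  fun_prop

theorem norm_phase (θ : Set.Icc (0 : ℝ) (2 * π)) : ‖phase θ‖ = 1 :=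
  Complex.norm_exp_ofReal_mul_I _

theorem phase_ne_zero (θ : Set.Icc (0 : ℝ) (2 * π)) : phase θ ≠ 0 :=
  Complex.exp_ne_zero _

/-- The largest moment of order `-s` of the distance from a point of the plane to a uniformly
distributed point of the unit circle. -/
noncomputable def circleMoment (s : ℝ) : ℝ≥0∞ :=
  ⨆ c : ℂ, ∫⁻ θ, ‖c + phase θ‖ₑ ^ (-s) ∂uniformAngle

theorem circleMoment_ne_top {s : ℝ} (hs0 : 0 ≤ s) (hs1 : s < 1) : circleMoment s ≠ ∞ := by
  have hfinite : (ENNReal.ofReal (2 * π))⁻¹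
      * (2 * ∫⁻ t in Set.Ioc (-(π / 2)) (π / 2), ‖Real.sin t‖ₑ ^ (-s)) ≠ ∞ :=
    ENNReal.mul_ne_top (by simp [Real.pi_pos])
      (ENNReal.mul_ne_top (by simp) (setLIntegral_abs_sin_rpow_lt_top hs0 hs1).ne)
  refine ne_top_of_le_ne_top hfinite (iSup_le fun c => ?_)
  rw [← setLIntegral_abs_sin_sub_rpow s c.arg, ← lintegral_uniformAngle]
  exact lintegral_mono fun θ =>
    enorm_rpow_neg_le_of_norm_le hs0 (abs_sin_sub_arg_le_norm_add_exp c θ)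

theorem lintegral_add_mul_phase_le_leading {s : ℝ} (hs : 0 < s) (p q : ℂ) :
    ∫⁻ θ, ‖p + q * phase θ‖ₑ ^ (-s) ∂uniformAngle ≤ ‖q‖ₑ ^ (-s) * circleMoment s := by
  rcases eq_or_ne q 0 with rfl | hq
  · have circleMoment_ne_zero : circleMoment s ≠ 0 := by
      refine ne_of_gt (lt_of_lt_of_le ?_ (le_iSup _ 0))
      simp [← ofReal_norm, norm_phase]
    simp [hs, circleMoment_ne_zero]
  · have factor (θ : Set.Icc (0 : ℝ) (2 * π)) :
        ‖p + q * phase θ‖ₑ ^ (-s) = ‖q‖ₑ ^ (-s) * ‖p / q + phase θ‖ₑ ^ (-s) := by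
      rw [← ENNReal.mul_rpow_of_ne_top enorm_ne_top enorm_ne_top, ← enorm_mul, mul_add,
        mul_div_cancel₀ _ hq]
    simp_rw [factor]
    rw [lintegral_const_mul _ (by fun_prop)]
    gcongr
    exact le_iSup (fun c => ∫⁻ θ, ‖c + phase θ‖ₑ ^ (-s) ∂uniformAngle) (p / q)

theorem lintegral_add_mul_phase_le_constant {s : ℝ} (hs : 0 < s) (p q : ℂ) :
    ∫⁻ θ, ‖p + q * phase θ‖ₑ ^ (-s) ∂uniformAngle ≤ ‖p‖ₑ ^ (-s) * circleMoment s := by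
  have reflect (θ : Set.Icc (0 : ℝ) (2 * π)) :
      ‖p + q * phase θ‖ₑ = ‖star q + star p * phase θ‖ₑ := by
    have conj_mul_self : star (phase θ) * phase θ = 1 := by
      simpa [norm_phase] using Complex.conj_mul' (phase θ)
    have factor : star q + star p * phase θ = star (p + q * phase θ) * phase θ := by
      rw [star_add, star_mul']
      linear_combination -star q * conj_mul_self
    rw [factor, ← ofReal_norm, ← ofReal_norm, norm_mul, norm_phase, mul_one, norm_star]
  simp_rw [reflect]
  simpa [← ofReal_norm] using lintegral_add_mul_phase_le_leading hs (star q) (star p)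

theorem lintegral_bilinear_phase_le {s : ℝ} (hs : 0 < s) (a₀₀ a₁₀ a₀₁ a₁₁ : ℂ) {a : ℂ}
    (ha : ‖a‖ ≤ ‖a₀₀‖ ∨ ‖a‖ ≤ ‖a₁₁‖) :
    ∫⁻ θ, ∫⁻ η, ‖a₀₀ + a₁₀ * phase θ + a₀₁ * phase η + a₁₁ * phase θ * phase η‖ₑ ^ (-s)
      ∂uniformAngle ∂uniformAngle ≤ ‖a‖ₑ ^ (-s) * circleMoment s ^ 2 := by
  have affine (θ η : Set.Icc (0 : ℝ) (2 * π)) :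
      a₀₀ + a₁₀ * phase θ + a₀₁ * phase η + a₁₁ * phase θ * phase η
        = (a₀₀ + a₁₀ * phase θ) + (a₀₁ + a₁₁ * phase θ) * phase η := by ring
  simp_rw [affine]
  rw [sq, ← mul_assoc]
  rcases ha with ha | ha
  · refine (lintegral_mono fun θ => lintegral_add_mul_phase_le_constant hs _ _).trans ?_
    rw [lintegral_mul_const _ (by fun_prop)]
    gcongr
    refine (lintegral_add_mul_phase_le_constant hs _ _).trans ?_
    exact mul_le_mul_left (enorm_rpow_neg_le_of_norm_le hs.le ha) _
  · refine (lintegral_mono fun θ => lintegral_add_mul_phase_le_leading hs _ _).trans ?_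
    rw [lintegral_mul_const _ (by fun_prop)]
    gcongr
    refine (lintegral_add_mul_phase_le_leading hs _ _).trans ?_
    exact mul_le_mul_left (enorm_rpow_neg_le_of_norm_le hs.le ha) _

theorem enorm_rpow_le_mul_enorm_rpow_neg {s : ℝ} (hs : 0 < s) {f b a : ℂ} (ha : a ≠ 0)
    (h : ‖f‖ * ‖b‖ ≤ ‖a‖) : ‖f‖ₑ ^ s ≤ ‖a‖ₑ ^ s * ‖b‖ₑ ^ (-s) := by
  have hle : ‖f‖ₑ ≤ ‖a‖ₑ * ‖b‖ₑ⁻¹ := by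
    rw [← div_eq_mul_inv, ENNReal.le_div_iff_mul_le (.inr (by simpa using ha)) (.inl enorm_ne_top),
      ← enorm_mul, enorm_le_iff_norm_le, norm_mul]
    exact h
  calc ‖f‖ₑ ^ s ≤ (‖a‖ₑ * ‖b‖ₑ⁻¹) ^ s := ENNReal.rpow_le_rpow hle hs.le
    _ = ‖a‖ₑ ^ s * ‖b‖ₑ ^ (-s) := by
      rw [ENNReal.mul_rpow_of_nonneg _ _ hs.le, ENNReal.inv_rpow, ENNReal.rpow_neg]

theorem lintegral_inner_resolvent_linePhase_le {H : Type*} [NormedAddCommGroup H]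
    [InnerProductSpace ℂ H] [CompleteSpace H] {s : ℝ} (hs : 0 < s)
    {W : H →L[ℂ] H} (hW : W ∈ unitary (H →L[ℂ] H)) {x y : H} (hx : ‖x‖ = 1) (hy : ‖y‖ = 1)
    (hxy : inner ℂ x y = (0 : ℂ)) {z : ℂ} (hz : ‖z‖ ≠ 1)
    (ψ : Set.Icc (0 : ℝ) (2 * π) → Set.Icc (0 : ℝ) (2 * π) → H)
    (hψ : ∀ θ η, linePhase x (phase θ) (linePhase y (phase η) (W (ψ θ η))) - z • ψ θ η = y) :
    ∫⁻ θ, ∫⁻ η, ‖z * inner ℂ x (ψ θ η)‖ₑ ^ s ∂uniformAngle ∂uniformAngle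
      ≤ circleMoment s ^ 2 := by
  obtain ⟨c, a₀₀, a₁₀, a₀₁, a₁₁, hc, hcoeff⟩ := exists_inner_mul_bilinear_eq hW hx hy hxy hz
  obtain ⟨a, ha, hca, haa⟩ : ∃ a : ℂ, a ≠ 0 ∧ ‖c‖ ≤ ‖a‖ ∧ (‖a‖ ≤ ‖a₀₀‖ ∨ ‖a‖ ≤ ‖a₁₁‖) := by
    rcases hc with ⟨h0, h⟩ | ⟨h0, h⟩
    exacts [⟨a₀₀, h0, h, .inl le_rfl⟩, ⟨a₁₁, h0, h, .inr le_rfl⟩]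
  have pointwise (θ η : Set.Icc (0 : ℝ) (2 * π)) : ‖z * inner ℂ x (ψ θ η)‖ₑ ^ s ≤
      ‖a‖ₑ ^ s * ‖a₀₀ + a₁₀ * phase θ + a₀₁ * phase η + a₁₁ * phase θ * phase η‖ₑ ^ (-s) := by
    refine enorm_rpow_le_mul_enorm_rpow_neg hs ha ?_
    rw [← norm_mul, hcoeff _ _ (phase_ne_zero θ) (phase_ne_zero η) _ (hψ θ η), norm_mul,
      norm_phase, one_mul]
    exact hca
  have cancel : ‖a‖ₑ ^ s * ‖a‖ₑ ^ (-s) = 1 := by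
    rw [← ENNReal.rpow_add _ _ (by simpa using ha) enorm_ne_top, add_neg_cancel, ENNReal.rpow_zero]
  calc ∫⁻ θ, ∫⁻ η, ‖z * inner ℂ x (ψ θ η)‖ₑ ^ s ∂uniformAngle ∂uniformAngle
      ≤ ∫⁻ θ, ∫⁻ η, ‖a‖ₑ ^ s *
          ‖a₀₀ + a₁₀ * phase θ + a₀₁ * phase η + a₁₁ * phase θ * phase η‖ₑ ^ (-s)
          ∂uniformAngle ∂uniformAngle :=
        lintegral_mono fun θ => lintegral_mono fun η => pointwise θ η
    _ = ‖a‖ₑ ^ s * ∫⁻ θ, ∫⁻ η,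
          ‖a₀₀ + a₁₀ * phase θ + a₀₁ * phase η + a₁₁ * phase θ * phase η‖ₑ ^ (-s)
          ∂uniformAngle ∂uniformAngle := by
        have finite : ‖a‖ₑ ^ s ≠ ∞ := ENNReal.rpow_ne_top_of_nonneg hs.le enorm_ne_top
        simp_rw [lintegral_const_mul' _ _ finite]
    _ ≤ ‖a‖ₑ ^ s * (‖a‖ₑ ^ (-s) * circleMoment s ^ 2) := by
        gcongr
        exact lintegral_bilinear_phase_le hs _ _ _ _ haa
    _ = circleMoment s ^ 2 := by rw [← mul_assoc, cancel, one_mul]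

end Circle

/-! ### Resampling an angle -/

section Resampling

open scoped ENNReal Real

theorem infinitePi_preimage_update_pi {ι : Type*} [DecidableEq ι] {X : ι → Type*}
    [∀ i, MeasurableSpace (X i)] (μ : ∀ i, Measure (X i)) [∀ i, IsProbabilityMeasure (μ i)] (n : ι)
    {f : X n → X n} (hf : Measurable f) (s : Finset ι) {t : ∀ i, Set (X i)}
    (ht : ∀ i, MeasurableSet (t i)) :
    Measure.infinitePi μ ((fun ω => Function.update ω n (f (ω n))) ⁻¹' Set.pi s t)
      = ∏ i ∈ s, Function.update (fun i => μ i (t i)) n (μ n (f ⁻¹' t n)) i := by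
  have preimage_eq : (fun ω => Function.update ω n (f (ω n))) ⁻¹' Set.pi s t
      = Set.pi s (Function.update t n (f ⁻¹' t n)) := by
    ext ω
    refine forall₂_congr fun i _ => ?_
    rcases eq_or_ne i n with rfl | hi
    · simp
    · simp [hi]
  have measurableSet_update (i : ι) : MeasurableSet (Function.update t n (f ⁻¹' t n) i) := by
    rcases eq_or_ne i n with rfl | hi
    · simpa using hf (ht i)
    · simpa [hi] using ht i
  rw [preimage_eq, Measure.infinitePi_pi _ fun i _ => measurableSet_update i]
  exact Finset.prod_congr rfl fun i _ => Function.apply_update (fun i => μ i) t n _ i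

theorem measurePreserving_update_infinitePi {ι T : Type*} [DecidableEq ι] {X : ι → Type*}
    [∀ i, MeasurableSpace (X i)] [MeasurableSpace T] {μ : ∀ i, Measure (X i)}
    [∀ i, IsProbabilityMeasure (μ i)] {ν : Measure T} [IsProbabilityMeasure ν] {n : ι}
    {g : T × X n → X n} (hg : MeasurePreserving g (ν.prod (μ n)) (μ n)) :
    MeasurePreserving (fun q : T × (∀ i, X i) => Function.update q.2 n (g (q.1, q.2 n)))
      (ν.prod (Measure.infinitePi μ)) (Measure.infinitePi μ) := by
  have measurable : Measurable fun q : T × (∀ i, X i) =>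
      Function.update q.2 n (g (q.1, q.2 n)) := by
    refine measurable_pi_lambda _ fun i => ?_
    rcases eq_or_ne i n with rfl | hi
    · simp only [Function.update_self]
      exact hg.measurable.comp (by fun_prop)
    · simp only [Function.update_of_ne hi]
      fun_prop
  refine ⟨measurable, Measure.eq_infinitePi _ fun s t ht => ?_⟩
  have measurableSet_box : MeasurableSet (Set.pi (s : Set ι) t) :=
    .pi s.countable_toSet fun i _ => ht i
  have measurable_section (θ : T) : Measurable fun x => g (θ, x) :=
    hg.measurable.comp measurable_prodMk_left
  rw [Measure.map_apply measurable measurableSet_box,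
    Measure.prod_apply (measurable measurableSet_box)]
  refine (lintegral_congr fun θ =>
    infinitePi_preimage_update_pi μ n (measurable_section θ) s ht).trans ?_
  by_cases hn : n ∈ s
  · have average : ∫⁻ θ, μ n ((fun x => g (θ, x)) ⁻¹' t n) ∂ν = μ n (t n) := by
      rw [← hg.measure_preimage (ht n).nullMeasurableSet, Measure.prod_apply (hg.measurable (ht n))]
      rfl
    have measurable_measure : Measurable fun θ => μ n ((fun x => g (θ, x)) ⁻¹' t n) :=
      measurable_measure_prodMk_left (hg.measurable (ht n))
    simp_rw [Finset.prod_update_of_mem hn]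
    rw [lintegral_mul_const _ measurable_measure, average,
      ← Finset.erase_eq, Finset.mul_prod_erase s (fun i => μ i (t i)) hn]
  · simp_rw [Finset.prod_update_of_notMem hn]
    simp

theorem measurePreserving_prodMap_fst {T X Y : Type*} [MeasurableSpace T] [MeasurableSpace X]
    [MeasurableSpace Y] {ν : Measure T} {μ : Measure X} {κ : Measure Y} [SFinite ν] [SFinite μ]
    [SFinite κ] {g : T × X → X} (hg : MeasurePreserving g (ν.prod μ) μ) :
    MeasurePreserving (fun q : T × (X × Y) => (g (q.1, q.2.1), q.2.2)) (ν.prod (μ.prod κ))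
      (μ.prod κ) :=
  (hg.prod (.id κ)).comp ((measurePreserving_prodAssoc ν μ κ).symm _)

theorem measurePreserving_prodMap_snd {T X Y : Type*} [MeasurableSpace T] [MeasurableSpace X]
    [MeasurableSpace Y] {ν : Measure T} {μ : Measure X} {κ : Measure Y} [SFinite ν] [SFinite μ]
    [SFinite κ] {g : T × X → X} (hg : MeasurePreserving g (ν.prod μ) μ) :
    MeasurePreserving (fun q : T × (Y × X) => (q.2.1, g (q.1, q.2.2))) (ν.prod (κ.prod μ))
      (κ.prod μ) :=
  Measure.measurePreserving_swap.comp ((measurePreserving_prodMap_fst hg).comp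
    ((MeasurePreserving.id ν).prod Measure.measurePreserving_swap))

variable {L : ℕ}

/-- The half sample `h` with its angle of index `i` replaced by `θ`. -/
def setHalfAngle (i : Fin L) (θ : Set.Icc (0 : ℝ) (2 * π)) (h : HalfSample L) : HalfSample L :=
  (h.1, h.2.1, Function.update h.2.2 i θ)

open Classical in
/-- The sample `ω` with one angle replaced by `θ`, namely the angle of index `i` in the phase which
the layers apply at the site `k`: that of `V^{(k-1)}` if `k` is odd, that of `U^{(k-1)}` if `k` is
even. -/
noncomputable def setAngle (k : ℤ) (i : Fin L) (θ : Set.Icc (0 : ℝ) (2 * π)) (ω : Sample L) :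
    Sample L :=
  Function.update ω (k - 1)
    (if Odd k then (setHalfAngle i θ (ω (k - 1)).1, (ω (k - 1)).2)
      else ((ω (k - 1)).1, setHalfAngle i θ (ω (k - 1)).2))

theorem isProbabilityMeasure_halfLaw (L : ℕ) {p : ℝ} (h0 : 0 ≤ p) (h1 : p ≤ 1) :
    IsProbabilityMeasure (halfLaw L p) := by
  have := isProbabilityMeasure_bernoulliSign h0 h1
  unfold halfLaw
  infer_instance

theorem measurePreserving_setHalfAngle (i : Fin L) {p : ℝ} (h0 : 0 ≤ p) (h1 : p ≤ 1) :
    MeasurePreserving (fun x : Set.Icc (0 : ℝ) (2 * π) × HalfSample L => setHalfAngle i x.1 x.2)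
      (uniformAngle.prod (halfLaw L p)) (halfLaw L p) := by
  have := isProbabilityMeasure_bernoulliSign h0 h1
  have update : MeasurePreserving
      (fun x : Set.Icc (0 : ℝ) (2 * π) × (Fin L → Set.Icc (0 : ℝ) (2 * π)) =>
        Function.update x.2 i x.1)
      (uniformAngle.prod (Measure.pi fun _ => uniformAngle))
      (Measure.pi fun _ => uniformAngle) := by
    rw [← Measure.infinitePi_eq_pi]
    exact measurePreserving_update_infinitePi (μ := fun _ => uniformAngle) (n := i)
      (g := Prod.fst) measurePreserving_fst
  exact measurePreserving_prodMap_snd (measurePreserving_prodMap_snd update)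

theorem measurePreserving_setAngle (k : ℤ) (i : Fin L) {p : ℝ} (h0 : 0 ≤ p) (h1 : p ≤ 1) :
    MeasurePreserving (fun x : Set.Icc (0 : ℝ) (2 * π) × Sample L => setAngle k i x.1 x.2)
      (uniformAngle.prod (law L p)) (law L p) := by
  have := isProbabilityMeasure_halfLaw L h0 h1
  have : IsProbabilityMeasure (siteLaw L p) := by unfold siteLaw; infer_instance
  refine measurePreserving_update_infinitePi (μ := fun _ : ℤ => siteLaw L p) (n := k - 1)
    (g := fun x => if Odd k then (setHalfAngle i x.1 x.2.1, x.2.2)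
      else (x.2.1, setHalfAngle i x.1 x.2.2)) ?_
  split_ifs
  · exact measurePreserving_prodMap_fst (measurePreserving_setHalfAngle i h0 h1)
  · exact measurePreserving_prodMap_snd (measurePreserving_setHalfAngle i h0 h1)

theorem lintegral_lintegral_comp_eq {T Ω : Type*} [MeasurableSpace T] [MeasurableSpace Ω]
    {ν : Measure T} {μ : Measure Ω} [SFinite ν] [SFinite μ] {f : T × Ω → Ω}
    (hf : MeasurePreserving f (ν.prod μ) μ) {F : Ω → ℝ≥0∞} (hF : Measurable F) :
    ∫⁻ ω, ∫⁻ θ, F (f (θ, ω)) ∂ν ∂μ = ∫⁻ ω, F ω ∂μ := by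
  rw [← hf.lintegral_comp hF]
  exact (lintegral_prod_symm _ (hF.comp hf.measurable).aemeasurable).symm

theorem lintegral_law_le_of_setAngle (k l : ℤ) (i j : Fin L) {p : ℝ} (h0 : 0 ≤ p) (h1 : p ≤ 1)
    {F : Sample L → ℝ≥0∞} (hF : Measurable F) {C : ℝ≥0∞}
    (h : ∀ ω, ∫⁻ θ, ∫⁻ η, F (setAngle k i θ (setAngle l j η ω)) ∂uniformAngle ∂uniformAngle ≤ C) :
    ∫⁻ ω, F ω ∂(law L p) ≤ C := by
  have := isProbabilityMeasure_law L h0 h1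
  have hk := measurePreserving_setAngle (L := L) k i h0 h1
  have hl := measurePreserving_setAngle (L := L) l j h0 h1
  have hFk := hF.comp hk.measurable
  calc ∫⁻ ω, F ω ∂(law L p)
      = ∫⁻ ω, ∫⁻ η, ∫⁻ θ, F (setAngle k i θ (setAngle l j η ω)) ∂uniformAngle ∂uniformAngle
          ∂(law L p) := by
        rw [← lintegral_lintegral_comp_eq hk hF]
        exact (lintegral_lintegral_comp_eq hl hFk.lintegral_prod_left').symm
    _ ≤ ∫⁻ _, C ∂(law L p) := by
        refine lintegral_mono fun ω => (lintegral_lintegral_swap ?_).trans_le (h ω)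
        exact (hFk.comp (measurable_snd.prodMk
          ((hl.measurable.comp measurable_prodMk_right).comp measurable_fst))).aemeasurable
    _ = C := by rw [lintegral_const, measure_univ, mul_one]

end Resampling

/-! ### The dependence of the zipper on an angle -/

section SiteOp

variable {L : ℕ} {I : Set ℤ}

open Classical in
/-- The operator acting by `E` at the site `k` and trivially at the other sites. -/
noncomputable def siteOp (k : I) (E : Matrix (Fin L) (Fin L) ℂ) : Hil L I →L[ℂ] Hil L I :=
  diagOp (fun i => op (if i = k then E else 1))
    ⟨max ‖op E‖ ‖op (1 : Matrix (Fin L) (Fin L) ℂ)‖, fun i => by split_ifs <;> simp⟩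

theorem siteOp_one (k : I) (f : Hil L I) : siteOp k 1 f = f := by
  ext1
  funext i
  simp [siteOp, diagOp_apply]

variable {α : Matrix (Fin L) (Fin L) ℂ} {bl br : UL L} {ω ω' : Sample L} {r : ℤ}

theorem Uph_congr {n : ℤ} (h : ω' n = ω n) : Uph ω' n = Uph ω n := by simp only [Uph, h]

theorem Vph_congr {n : ℤ} (h : ω' n = ω n) : Vph ω' n = Vph ω n := by simp only [Vph, h]

section Factor

variable {k : I} (hk : (k : ℤ) - 1 ∈ I) (hr : ¬Even ((k : ℤ) - r))
  (hω : ∀ m, m ≠ (k : ℤ) - 1 → ω' m = ω m) {E F : Matrix (Fin L) (Fin L) ℂ}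
  (hV : (Vph ω' (k - 1) : Matrix (Fin L) (Fin L) ℂ) = E * Vph ω (k - 1))
  (hU : (Uph ω' (k - 1) : Matrix (Fin L) (Fin L) ℂ) = Uph ω (k - 1) * F)

include hr hω hV hU

open Classical in
theorem layerOff_eq_mul_mul (i : I) :
    layerOff α ω' r i =
      (if i = k then E else 1) * layerOff α ω r i * (if mateIn r i = k then F else 1) := by
  by_cases hi : mate r i ∈ I
  swap
  · rw [layerOff_of_notMem hi, layerOff_of_notMem hi, mul_zero, zero_mul]
  by_cases he : Even ((i : ℤ) - r)
  · have hik : i ≠ k := fun h => hr (h ▸ he)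
    have hmate : mateIn r i = k ↔ (i : ℤ) = k - 1 := by
      rw [Subtype.ext_iff, coe_mateIn_of_even hi he, eq_sub_iff_add_eq]
    rw [layerOff_of_even hi he, layerOff_of_even hi he, if_neg hik, one_mul, blockB, blockB]
    by_cases h : (i : ℤ) = k - 1
    · rw [if_pos (hmate.2 h), h, hU, mul_assoc]
    · rw [if_neg (mt hmate.1 h), mul_one, Uph_congr (hω _ h)]
  · have hmate : mateIn r i ≠ k := fun h => by
      rw [mateIn_of_mem hi] at h
      exact hr (h ▸ by_contra fun h' => he (not_even_mate_sub.1 h'))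
    rw [layerOff_of_not_even hi he, layerOff_of_not_even hi he, if_neg hmate, mul_one, blockC,
      blockC]
    by_cases hik : i = k
    · rw [if_pos hik, hik, hV, mul_assoc]
    · rw [if_neg hik, one_mul,
        Vph_congr (hω _ fun h => hik (Subtype.ext (sub_left_injective h)))]

include hk

open Classical in
theorem layerDiag_eq_mul_mul (i : I) :
    layerDiag α bl br ω' r i =
      (if i = k then E else 1) * layerDiag α bl br ω r i * (if i = k then F else 1) := by
  have hkI : mate r k ∈ I := by rwa [mate_of_not_even hr]
  by_cases hik : i = k
  · subst hik
    rw [layerDiag_of_not_even hkI hr, layerDiag_of_not_even hkI hr, if_pos rfl, if_pos rfl, blockD,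
      blockD, hV, hU]
    noncomm_ring
  · have hne : (i : ℤ) - 1 ≠ k - 1 := fun h => hik (Subtype.ext (sub_left_injective h))
    simp only [layerDiag, blockD, Uph_congr (hω _ hne), Vph_congr (hω _ hne), if_neg hik, one_mul,
      mul_one]

theorem layer_eq_siteOp (f : Hil L I) :
    layer α bl br I ω' r f = siteOp k E (layer α bl br I ω r (siteOp k F f)) := by
  ext1
  funext i
  simp only [layer_apply, siteOp, diagOp_apply, layerDiag_eq_mul_mul hk hr hω hV hU,
    layerOff_eq_mul_mul hr hω hV hU, op_mul_apply, map_add]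

end Factor

theorem layer_congr_of_even {k : ℤ} (hr : Even (k - r)) (hω : ∀ m, m ≠ k - 1 → ω' m = ω m) :
    layer α bl br I ω' r = layer α bl br I ω r := by
  ext1 f
  ext1
  funext i
  rw [layer_apply, layer_apply]
  by_cases h : Even ((i : ℤ) - r)
  · have hne : (i : ℤ) ≠ k - 1 := by grind
    simp only [layerDiag, layerOff, h, if_true, blockB, Uph_congr (hω _ hne)]
  · have hne : (i : ℤ) - 1 ≠ k - 1 := by grind
    simp only [layerDiag, layerOff, h, if_false, blockC, blockD, Uph_congr (hω _ hne),
      Vph_congr (hω _ hne)]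

end SiteOp

section Frame

variable {L : ℕ}

/-- The random reflection `Ũ D Ũ^*` of a half sample. -/
noncomputable def reflection (h : HalfSample L) : UL L := h.1 * signU h.2.1 * h.1⁻¹

/-- The unitary whose columns are the eigenvectors of the phase multiplication which a change of the
angles in `setAngle k` amounts to: `V^{(k-1)}` is a reflection followed by phases, `U^{(k-1)}` is
phases followed by a reflection. -/
noncomputable def frame (ω : Sample L) (k : ℤ) : UL L :=
  if Odd k then reflection (ω (k - 1)).1 else (reflection (ω (k - 1)).2)⁻¹

/-- The angle zero, at which the reference sample has its resampled angles. -/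
noncomputable def zeroAngle : Set.Icc (0 : ℝ) (2 * Real.pi) := ⟨0, le_refl _, by positivity⟩

/-- The diagonal unitary with the entry `e^{iθ}` at `p` and `1` elsewhere. -/
noncomputable def coordPhase (p : Fin L) (θ : Set.Icc (0 : ℝ) (2 * Real.pi)) : UL L :=
  phaseU (Function.update (fun _ => zeroAngle) p θ)

theorem coe_phaseU (φ : Fin L → Set.Icc (0 : ℝ) (2 * Real.pi)) :
    (phaseU φ : Matrix (Fin L) (Fin L) ℂ) = Matrix.diagonal fun i => phase (φ i) := rfl

theorem phase_zeroAngle : phase zeroAngle = 1 := by simp [phase, zeroAngle]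

theorem phaseU_commute (φ φ' : Fin L → Set.Icc (0 : ℝ) (2 * Real.pi)) :
    Commute (phaseU φ) (phaseU φ') := by
  apply Subtype.ext
  simp only [Submonoid.coe_mul, coe_phaseU, Matrix.diagonal_mul_diagonal, mul_comm]

theorem phaseU_update (φ : Fin L → Set.Icc (0 : ℝ) (2 * Real.pi)) (p : Fin L)
    (θ : Set.Icc (0 : ℝ) (2 * Real.pi)) :
    phaseU (Function.update φ p θ) =
      coordPhase p θ * phaseU (Function.update φ p zeroAngle) := by
  apply Subtype.ext
  simp only [coordPhase, Submonoid.coe_mul, coe_phaseU, Matrix.diagonal_mul_diagonal]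
  congr 1
  funext i
  rcases eq_or_ne i p with rfl | hi
  · simp [phase_zeroAngle]
  · simp [hi, phase_zeroAngle]

theorem setAngle_of_ne {k m : ℤ} (h : m ≠ k - 1) (p : Fin L)
    (θ : Set.Icc (0 : ℝ) (2 * Real.pi)) (ω : Sample L) : setAngle k p θ ω m = ω m :=
  Function.update_of_ne h _ _

theorem setAngle_apply_of_odd {k : ℤ} (h : Odd k) (p : Fin L)
    (θ : Set.Icc (0 : ℝ) (2 * Real.pi)) (ω : Sample L) :
    setAngle k p θ ω (k - 1) = (setHalfAngle p θ (ω (k - 1)).1, (ω (k - 1)).2) := by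
  simp [setAngle, h]

theorem setAngle_apply_of_not_odd {k : ℤ} (h : ¬Odd k) (p : Fin L)
    (θ : Set.Icc (0 : ℝ) (2 * Real.pi)) (ω : Sample L) :
    setAngle k p θ ω (k - 1) = ((ω (k - 1)).1, setHalfAngle p θ (ω (k - 1)).2) := by
  simp [setAngle, h]

theorem setAngle_comm {k l : ℤ} (h : k ≠ l) (p q : Fin L) (θ η : Set.Icc (0 : ℝ) (2 * Real.pi))
    (ω : Sample L) : setAngle k p θ (setAngle l q η ω) = setAngle l q η (setAngle k p θ ω) := by
  have hne : k - 1 ≠ l - 1 := fun h' => h (sub_left_injective h')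
  rw [setAngle, setAngle_of_ne hne, setAngle, Function.update_comm hne.symm, setAngle,
    setAngle_of_ne hne.symm, setAngle]

theorem frame_setAngle (ω : Sample L) (k l : ℤ) (p : Fin L) (θ : Set.Icc (0 : ℝ) (2 * Real.pi)) :
    frame (setAngle l p θ ω) k = frame ω k := by
  rcases eq_or_ne k l with rfl | h
  · by_cases ho : Odd k
    · rw [frame, frame, if_pos ho, if_pos ho, setAngle_apply_of_odd ho]
      rfl
    · rw [frame, frame, if_neg ho, if_neg ho, setAngle_apply_of_not_odd ho]
      rfl
  · rw [frame, frame, setAngle_of_ne fun h' => h (sub_left_injective h')]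

theorem Vph_setAngle {k : ℤ} (h : Odd k) (p : Fin L) (θ : Set.Icc (0 : ℝ) (2 * Real.pi))
    (ω : Sample L) :
    Vph (setAngle k p θ ω) (k - 1) =
      frame ω k * coordPhase p θ * (frame ω k)⁻¹ * Vph (setAngle k p zeroAngle ω) (k - 1) := by
  have hVph (η : Set.Icc (0 : ℝ) (2 * Real.pi)) : Vph (setAngle k p η ω) (k - 1) =
      frame ω k * phaseU (Function.update (ω (k - 1)).1.2.2 p η) := by
    rw [Vph, setAngle_apply_of_odd h, frame, if_pos h]
    rfl
  rw [hVph, hVph, phaseU_update _ p θ]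
  group

theorem Uph_setAngle {k : ℤ} (h : ¬Odd k) (p : Fin L) (θ : Set.Icc (0 : ℝ) (2 * Real.pi))
    (ω : Sample L) :
    Uph (setAngle k p θ ω) (k - 1) =
      Uph (setAngle k p zeroAngle ω) (k - 1) *
        (frame ω k * coordPhase p θ * (frame ω k)⁻¹) := by
  have hUph (η : Set.Icc (0 : ℝ) (2 * Real.pi)) : Uph (setAngle k p η ω) (k - 1) =
      phaseU (Function.update (ω (k - 1)).2.2.2 p η) * (frame ω k)⁻¹ := by
    rw [Uph, setAngle_apply_of_not_odd h, frame, if_neg h, inv_inv, reflection, mul_assoc,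
      mul_assoc, mul_assoc]
    rfl
  rw [hUph, hUph, phaseU_update _ p θ, coordPhase, phaseU_commute]
  group

theorem Vph_setAngle_of_not_odd {k : ℤ} (h : ¬Odd k) (p : Fin L)
    (θ : Set.Icc (0 : ℝ) (2 * Real.pi)) (ω : Sample L) :
    Vph (setAngle k p θ ω) (k - 1) = Vph ω (k - 1) := by
  rw [Vph, setAngle_apply_of_not_odd h, Vph]

theorem Uph_setAngle_of_odd {k : ℤ} (h : Odd k) (p : Fin L) (θ : Set.Icc (0 : ℝ) (2 * Real.pi))
    (ω : Sample L) : Uph (setAngle k p θ ω) (k - 1) = Uph ω (k - 1) := by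
  rw [Uph, setAngle_apply_of_odd h, Uph]

variable {I : Set ℤ}

open Classical in
/-- The column of index `p` of `frame ω k`, placed at the site `k`. -/
noncomputable def frameVec (ω : Sample L) (k : I) (p : Fin L) : Hil L I :=
  lp.single 2 k (op (frame ω k : Matrix (Fin L) (Fin L) ℂ) (EuclideanSpace.single p (1 : ℂ)))

theorem frameVec_setAngle (ω : Sample L) (k : I) (l : ℤ) (p q : Fin L)
    (θ : Set.Icc (0 : ℝ) (2 * Real.pi)) :
    frameVec (setAngle l p θ ω) k q = frameVec ω k q := by
  rw [frameVec, frame_setAngle, frameVec]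

theorem linePhase_map_of_mem_unitary {H : Type*} [NormedAddCommGroup H] [InnerProductSpace ℂ H]
    [CompleteSpace H] {U : H →L[ℂ] H} (hU : U ∈ unitary (H →L[ℂ] H)) (x : H) (u : ℂ) (v : H) :
    U (linePhase x u (star U v)) = linePhase (U x) u v := by
  have hv : U (star U v) = v := DFunLike.congr_fun (Unitary.mul_star_self_of_mem hU) v
  rw [linePhase_apply, linePhase_apply, map_add, map_smul, hv,
    ContinuousLinearMap.star_eq_adjoint, ContinuousLinearMap.adjoint_inner_right]

theorem op_coe_mem_unitary (F : UL L) :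
    op (F : Matrix (Fin L) (Fin L) ℂ) ∈ unitary (Fib L →L[ℂ] Fib L) :=
  Unitary.map_mem (Matrix.toEuclideanCLM (n := Fin L) (𝕜 := ℂ)) F.2

theorem op_coordPhase_apply (p : Fin L) (θ : Set.Icc (0 : ℝ) (2 * Real.pi)) (v : Fib L) :
    op (coordPhase p θ : Matrix (Fin L) (Fin L) ℂ) v =
      linePhase (EuclideanSpace.single p 1) (phase θ) v := by
  ext i
  have hmulVec : op (coordPhase p θ : Matrix (Fin L) (Fin L) ℂ) v i =
      phase (Function.update (fun _ => zeroAngle) p θ i) * v i :=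
    Matrix.mulVec_diagonal _ _ i
  rw [hmulVec, linePhase_apply]
  rcases eq_or_ne i p with rfl | hi
  · simp [EuclideanSpace.inner_single_left]
    ring
  · simp [hi, phase_zeroAngle]

theorem op_conj_coordPhase_apply (F : UL L) (p : Fin L) (θ : Set.Icc (0 : ℝ) (2 * Real.pi))
    (v : Fib L) :
    op ((F * coordPhase p θ * F⁻¹ : UL L) : Matrix (Fin L) (Fin L) ℂ) v =
      linePhase (op (F : Matrix (Fin L) (Fin L) ℂ) (EuclideanSpace.single p (1 : ℂ))) (phase θ)
        v := by
  rw [← linePhase_map_of_mem_unitary (op_coe_mem_unitary F), ← op_coordPhase_apply,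
    ← op_conjTranspose, ← op_mul_apply, ← op_mul_apply]
  rfl

open Classical in
theorem linePhase_single_apply (k : I) (ξ : Fib L) (u : ℂ) (f : Hil L I) (i : I) :
    linePhase (lp.single 2 k ξ : Hil L I) u f i =
      if i = k then linePhase ξ u (f i) else f i := by
  rw [linePhase_apply, lp.inner_single_left]
  change f i + ((u - 1) * inner ℂ ξ (f k)) • (lp.single 2 k ξ : Hil L I) i = _
  split_ifs with h
  · subst h
    rw [linePhase_apply, lp.single_apply_self]
  · rw [lp.single_apply_ne _ _ _ h, smul_zero, add_zero]

theorem siteOp_conj_coordPhase (ω : Sample L) (k : I) (p : Fin L)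
    (θ : Set.Icc (0 : ℝ) (2 * Real.pi)) (f : Hil L I) :
    siteOp k ((frame ω k * coordPhase p θ * (frame ω k)⁻¹ : UL L) : Matrix (Fin L) (Fin L) ℂ) f =
      linePhase (frameVec ω k p) (phase θ) f := by
  classical
  ext1
  funext i
  rw [siteOp, diagOp_apply, frameVec, linePhase_single_apply]
  split_ifs
  · exact op_conj_coordPhase_apply (frame ω k) p θ (f i)
  · simp

variable {α : Matrix (Fin L) (Fin L) ℂ} {bl br : UL L}

theorem layer_zero_setAngle {k : I} (hk : (k : ℤ) - 1 ∈ I) (ho : Odd (k : ℤ)) (p : Fin L)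
    (θ : Set.Icc (0 : ℝ) (2 * Real.pi)) (ω : Sample L) (f : Hil L I) :
    layer α bl br I (setAngle k p θ ω) 0 f =
      linePhase (frameVec ω k p) (phase θ) (layer α bl br I (setAngle k p zeroAngle ω) 0 f) := by
  rw [← siteOp_conj_coordPhase, layer_eq_siteOp (ω := setAngle k p zeroAngle ω) hk (by grind)
    (fun m hm => by rw [setAngle_of_ne hm, setAngle_of_ne hm]) (F := 1)
    (congrArg Subtype.val (Vph_setAngle ho p θ ω)) _, siteOp_one]
  rw [Uph_setAngle_of_odd ho, Uph_setAngle_of_odd ho, mul_one]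

theorem layer_one_setAngle {k : I} (hk : (k : ℤ) - 1 ∈ I) (ho : ¬Odd (k : ℤ)) (p : Fin L)
    (θ : Set.Icc (0 : ℝ) (2 * Real.pi)) (ω : Sample L) (f : Hil L I) :
    layer α bl br I (setAngle k p θ ω) 1 f =
      layer α bl br I (setAngle k p zeroAngle ω) 1 (linePhase (frameVec ω k p) (phase θ) f) := by
  rw [← siteOp_conj_coordPhase, layer_eq_siteOp (ω := setAngle k p zeroAngle ω) hk (by grind)
    (fun m hm => by rw [setAngle_of_ne hm, setAngle_of_ne hm]) (E := 1) _
    (congrArg Subtype.val (Uph_setAngle ho p θ ω)), siteOp_one]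
  rw [Vph_setAngle_of_not_odd ho, Vph_setAngle_of_not_odd ho, one_mul]

theorem zipper_setAngle {a b : WithBot (WithTop ℤ)} {k : sites a b} (hk : (k : ℤ) - 1 ∈ sites a b)
    (p : Fin L) (θ : Set.Icc (0 : ℝ) (2 * Real.pi)) (ω : Sample L) (f : Hil L (sites a b)) :
    zipper α bl br a b (setAngle k p θ ω) f =
      linePhase (frameVec ω k p) (if Odd (k : ℤ) then phase θ else 1)
        (zipper α bl br a b (setAngle k p zeroAngle ω)
          (linePhase (frameVec ω k p) (if Odd (k : ℤ) then 1 else phase θ) f)) := by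
  have hω (m : ℤ) (hm : m ≠ k - 1) : setAngle k p θ ω m = setAngle k p zeroAngle ω m := by
    rw [setAngle_of_ne hm, setAngle_of_ne hm]
  simp only [zipper, ContinuousLinearMap.comp_apply]
  by_cases ho : Odd (k : ℤ)
  · rw [layer_zero_setAngle hk ho, layer_congr_of_even (by grind) hω, if_pos ho, if_pos ho,
      linePhase_one]
  · rw [layer_one_setAngle hk ho, layer_congr_of_even (r := 0) (by grind) hω, if_neg ho, if_neg ho,
      linePhase_one]

end Frame

/-! ### The Green kernel -/

section Green

variable {L : ℕ} {α : Matrix (Fin L) (Fin L) ℂ} {bl br : UL L} {a b : WithBot (WithTop ℤ)}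
  {ω : Sample L} {z : ℂ}

theorem zipper_resolventOp (hα : ‖op α‖ ≤ 1) (hz : ‖z‖ ≠ 1) (f : Hil L (sites a b)) :
    zipper α bl br a b ω (resolventOp α bl br a b ω z f) - z • resolventOp α bl br a b ω z f = f :=
  DFunLike.congr_fun (Ring.mul_inverse_cancel _
    (isUnit_sub_smul_id_of_mem_unitary (zipper_mem_unitary hα bl br a b ω) hz)) f

theorem star_zipper_star_resolventOp (hα : ‖op α‖ ≤ 1) (hz : ‖z‖ ≠ 1) (f : Hil L (sites a b)) :
    star (zipper α bl br a b ω) (star (resolventOp α bl br a b ω z) f) -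
      star z • star (resolventOp α bl br a b ω z) f = f := by
  have h := congrArg star (Ring.inverse_mul_cancel _
    (isUnit_sub_smul_id_of_mem_unitary (zipper_mem_unitary hα bl br a b ω) hz))
  rw [star_mul, star_sub, star_smul, ← ContinuousLinearMap.one_def, star_one] at h
  exact DFunLike.congr_fun h f

theorem inv_smul_zipper_resolventOp_add (hα : ‖op α‖ ≤ 1) (hz : ‖z‖ ≠ 1) (hz0 : z ≠ 0)
    (f : Hil L (sites a b)) :
    z⁻¹ • zipper α bl br a b ω (resolventOp α bl br a b ω z f) + -z⁻¹ • f =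
      resolventOp α bl br a b ω z f := by
  have h := zipper_resolventOp (ω := ω) (bl := bl) (br := br) hα hz f
  rw [sub_eq_iff_eq_add] at h
  rw [h, smul_add, smul_smul, inv_mul_cancel₀ hz0]
  module

theorem star_smul_zipper_star_resolventOp_add (hα : ‖op α‖ ≤ 1) (hz : ‖z‖ ≠ 1)
    (f : Hil L (sites a b)) :
    star z • zipper α bl br a b ω (star (resolventOp α bl br a b ω z) f) +
        zipper α bl br a b ω f =
      star (resolventOp α bl br a b ω z) f := by
  have hU (g : Hil L (sites a b)) : zipper α bl br a b ω (star (zipper α bl br a b ω) g) = g :=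
    DFunLike.congr_fun (Unitary.mul_star_self_of_mem (zipper_mem_unitary hα bl br a b ω)) g
  have h := congrArg (zipper α bl br a b ω)
    (star_zipper_star_resolventOp (ω := ω) (bl := bl) (br := br) hα hz f)
  rw [map_sub, map_smul, hU] at h
  rw [← h, add_sub_cancel]

theorem op_single_apply (A : Matrix (Fin L) (Fin L) ℂ) (p q : Fin L) :
    op A (EuclideanSpace.single q 1) p = A p q :=
  congrFun (Matrix.mulVec_single_one A q) p

open Classical in
theorem op_green_apply (k l : sites a b) (v : Fib L) :
    op (green α bl br a b ω z k l) v = resolventOp α bl br a b ω z (lp.single 2 l v) k := by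
  let T : Fib L →ₗ[ℂ] Fib L := lp.evalₗ (𝕜 := ℂ) (E := fun _ : sites a b => Fib L) 2 k ∘ₗ
    (resolventOp α bl br a b ω z : Hil L (sites a b) →ₗ[ℂ] Hil L (sites a b)) ∘ₗ
      lp.lsingle (𝕜 := ℂ) (E := fun _ : sites a b => Fib L) 2 l
  change (op (green α bl br a b ω z k l) : Fib L →ₗ[ℂ] Fib L) v = T v
  congr 1
  refine (EuclideanSpace.basisFun (Fin L) ℂ).toBasis.ext fun q => ?_
  ext p
  simp only [OrthonormalBasis.coe_toBasis, EuclideanSpace.basisFun_apply,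
    ContinuousLinearMap.coe_coe, op_single_apply, green, Matrix.of_apply, basisVec]
  rw [lp.inner_single_left, EuclideanSpace.inner_single_left, map_one, one_mul]
  rfl

open Classical in
theorem op_conjTranspose_green_apply (k l : sites a b) (v : Fib L) :
    op (green α bl br a b ω z k l).conjTranspose v =
      star (resolventOp α bl br a b ω z) (lp.single 2 k v) l := by
  refine ext_inner_right ℂ fun w => ?_
  rw [op_conjTranspose, ContinuousLinearMap.star_eq_adjoint,
    ContinuousLinearMap.adjoint_inner_left, op_green_apply]
  exact (lp.inner_single_left k v (resolventOp α bl br a b ω z (lp.single 2 l w))).symm.trans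
    ((ContinuousLinearMap.adjoint_inner_left _ _ _).symm.trans (lp.inner_single_right _ _ _))

end Green

/-! ### Measurability -/

section Measurability

theorem measurable_comp_of_isFixedPt {Ω ι X Y : Type*} [MeasurableSpace Ω] [MetricSpace X]
    [CompleteSpace X] [Nonempty X] [TopologicalSpace Y] [TopologicalSpace.PseudoMetrizableSpace Y]
    [MeasurableSpace Y] [BorelSpace Y] {e : ι → X → Y} (he : ∀ i, Continuous (e i))
    {T : Ω → X → X} {K : NNReal} (hK : ∀ ω, ContractingWith K (T ω))
    (hT : ∀ F : Ω → X, (∀ i, Measurable fun ω => e i (F ω)) →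
      ∀ i, Measurable fun ω => e i (T ω (F ω)))
    {G : Ω → X} (hG : ∀ ω, Function.IsFixedPt (T ω) (G ω)) (i : ι) :
    Measurable fun ω => e i (G ω) := by
  obtain ⟨x⟩ := ‹Nonempty X›
  have hiter (n : ℕ) : ∀ i, Measurable fun ω => e i ((T ω)^[n] x) := by
    induction n with
    | zero => simp
    | succ n ih => simpa only [Function.iterate_succ_apply'] using hT _ ih
  refine measurable_of_tendsto_metrizable (fun n => hiter n i) (tendsto_pi_nhds.2 fun ω => ?_)
  have hlim := (hK ω).tendsto_iterate_fixedPoint x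
  rw [← (hK ω).fixedPoint_unique (hG ω)] at hlim
  exact ((he i).tendsto _).comp hlim

theorem measurable_of_forall_apply {Ω : Type*} [MeasurableSpace Ω] {L : ℕ}
    {T : Ω → Fib L →L[ℂ] Fib L} (hT : ∀ v, Measurable fun ω => T ω v) : Measurable T := by
  have hsum : T = fun ω => ∑ q, ContinuousLinearMap.smulRightL ℂ (Fib L) (Fib L)
      (EuclideanSpace.proj q) (T ω (EuclideanSpace.single q 1)) := by
    funext ω
    refine ContinuousLinearMap.coe_injective
      ((EuclideanSpace.basisFun (Fin L) ℂ).toBasis.ext fun p => ?_)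
    simp
  rw [hsum]
  exact Finset.measurable_fun_sum _ fun q _ =>
    (ContinuousLinearMap.continuous _).measurable.comp (hT _)

variable {L : ℕ}

theorem continuous_op :
    Continuous fun A : Matrix (Fin L) (Fin L) ℂ => op A :=
  LinearMap.continuous_of_finiteDimensional
    (Matrix.toEuclideanCLM (n := Fin L) (𝕜 := ℂ)).toAlgEquiv.toLinearMap

theorem measurable_op_coe : Measurable fun u : UL L => op (u : Matrix (Fin L) (Fin L) ℂ) :=
  (continuous_op.comp continuous_subtype_val).measurable

theorem measurable_op_coe_inv :
    Measurable fun u : UL L => op ((u⁻¹ : UL L) : Matrix (Fin L) (Fin L) ℂ) :=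
  measurable_op_coe.comp measurable_inv

theorem measurable_signU : Measurable (signU (L := L)) := by
  have : MeasurableSingletonClass ℤˣ :=
    ⟨fun u => ⟨{(u : ℤ)}, trivial, by ext; simp [Units.ext_iff]⟩⟩
  exact measurable_of_finite _

theorem measurable_phaseU : Measurable (phaseU (L := L)) := by
  refine Continuous.measurable (Continuous.subtype_mk ?_ _)
  exact Continuous.matrix_diagonal (by fun_prop)

theorem measurable_op_reflection :
    Measurable fun h : HalfSample L => op (reflection h : Matrix (Fin L) (Fin L) ℂ) := by
  simp only [reflection, Submonoid.coe_mul, op, map_mul]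
  exact ((measurable_op_coe.comp measurable_fst).mul
    (measurable_op_coe.comp (measurable_signU.comp measurable_snd.fst))).mul
    (measurable_op_coe_inv.comp measurable_fst)

theorem measurable_star_continuousLinearMap :
    Measurable (star : (Fib L →L[ℂ] Fib L) → Fib L →L[ℂ] Fib L) :=
  ContinuousLinearMap.adjoint.continuous.measurable

theorem measurable_op_reflection_inv :
    Measurable fun h : HalfSample L => op ((reflection h)⁻¹ : UL L).1 := by
  have hstar (h : HalfSample L) : op ((reflection h)⁻¹ : UL L).1 = star (op (reflection h).1) :=
    op_conjTranspose _
  simp only [hstar]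
  exact measurable_star_continuousLinearMap.comp measurable_op_reflection

theorem measurable_op_frame (k : ℤ) :
    Measurable fun ω : Sample L => op (frame ω k : Matrix (Fin L) (Fin L) ℂ) := by
  unfold frame
  split_ifs
  · exact measurable_op_reflection.comp (measurable_pi_apply _).fst
  · exact measurable_op_reflection_inv.comp (measurable_pi_apply _).snd

theorem measurable_op_Uph (n : ℤ) :
    Measurable fun ω : Sample L => op (Uph ω n : Matrix (Fin L) (Fin L) ℂ) := by
  have hω : Measurable fun ω : Sample L => (ω n).2 := (measurable_pi_apply n).snd
  have hUph (ω : Sample L) : (Uph ω n : Matrix (Fin L) (Fin L) ℂ) =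
      phaseU (ω n).2.2.2 * reflection (ω n).2 := by
    simp only [Uph, reflection, Submonoid.coe_mul, mul_assoc]
  simp only [hUph, op, map_mul]
  exact (measurable_op_coe.comp (measurable_phaseU.comp hω.snd.snd)).mul
    (measurable_op_reflection.comp hω)

theorem measurable_op_Vph (n : ℤ) :
    Measurable fun ω : Sample L => op (Vph ω n : Matrix (Fin L) (Fin L) ℂ) := by
  have hω : Measurable fun ω : Sample L => (ω n).1 := (measurable_pi_apply n).fst
  have hVph (ω : Sample L) : (Vph ω n : Matrix (Fin L) (Fin L) ℂ) =
      reflection (ω n).1 * phaseU (ω n).1.2.2 := rfl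
  simp only [hVph, op, map_mul]
  exact (measurable_op_reflection.comp hω).mul
    (measurable_op_coe.comp (measurable_phaseU.comp hω.snd.snd))

variable {I : Set ℤ}

theorem measurable_op_layerDiag (α : Matrix (Fin L) (Fin L) ℂ) (bl br : UL L) (r : ℤ) (i : I) :
    Measurable fun ω : Sample L => op (layerDiag α bl br ω r i) := by
  unfold layerDiag
  split_ifs
  · exact measurable_const
  · simp only [blockD, op, map_neg, map_mul]
    exact (((measurable_op_Vph _).mul_const _).mul (measurable_op_Uph _)).neg
  · exact measurable_const
  · exact measurable_const

theorem measurable_op_layerOff (α : Matrix (Fin L) (Fin L) ℂ) (r : ℤ) (i : I) :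
    Measurable fun ω : Sample L => op (layerOff α ω r i) := by
  unfold layerOff
  split_ifs
  · simp only [blockB, op, map_mul]
    exact (measurable_op_Uph _).const_mul _
  · simp only [blockC, op, map_mul]
    exact (measurable_op_Vph _).mul_const _
  · exact measurable_const

theorem measurable_layer_apply (α : Matrix (Fin L) (Fin L) ℂ) (bl br : UL L) (r : ℤ)
    {F : Sample L → Hil L I} (hF : ∀ i, Measurable fun ω => F ω i) (i : I) :
    Measurable fun ω => layer α bl br I ω r (F ω) i := by
  simp only [layer_apply]
  exact (ContinuousLinearMap.measurable_apply₂.comp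
    ((measurable_op_layerDiag α bl br r i).prodMk (hF i))).add
    (ContinuousLinearMap.measurable_apply₂.comp
      ((measurable_op_layerOff α r i).prodMk (hF (mateIn r i))))

variable {α : Matrix (Fin L) (Fin L) ℂ} {bl br : UL L} {a b : WithBot (WithTop ℤ)} {z : ℂ}

theorem contractingWith_smul_zipper_add (hα : ‖op α‖ ≤ 1) {c : ℂ} (hc : ‖c‖ < 1) (ω : Sample L)
    (g : Hil L (sites a b)) :
    ContractingWith ‖c‖₊ fun f => c • zipper α bl br a b ω f + g := by
  refine ⟨hc, LipschitzWith.of_dist_le_mul fun f f' => le_of_eq ?_⟩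
  have hdist : dist (zipper α bl br a b ω f) (zipper α bl br a b ω f') = dist f f' :=
    (Unitary.linearIsometryEquiv ⟨_, zipper_mem_unitary hα bl br a b ω⟩).dist_map f f'
  rw [dist_add_right, dist_smul₀, coe_nnnorm, hdist]

theorem measurable_zipper_apply (α : Matrix (Fin L) (Fin L) ℂ) (bl br : UL L)
    {F : Sample L → Hil L (sites a b)} (hF : ∀ i, Measurable fun ω => F ω i) (i : sites a b) :
    Measurable fun ω => zipper α bl br a b ω (F ω) i :=
  measurable_layer_apply α bl br 0 (measurable_layer_apply α bl br 1 hF) i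

theorem measurable_apply_of_smul_zipper_add (hα : ‖op α‖ ≤ 1) {c : ℂ} (hc : ‖c‖ < 1)
    {F G : Sample L → Hil L (sites a b)} (hF : ∀ i, Measurable fun ω => F ω i)
    (hG : ∀ ω, c • zipper α bl br a b ω (G ω) + F ω = G ω) (i : sites a b) :
    Measurable fun ω => G ω i := by
  refine measurable_comp_of_isFixedPt (e := fun i (f : Hil L (sites a b)) => f i)
    (fun i => (lp.lipschitzWith_one_eval 2 i).continuous)
    (fun ω => contractingWith_smul_zipper_add hα hc ω (F ω)) (fun H hH i => ?_) hG i
  exact ((measurable_zipper_apply α bl br hH i).const_smul c).add (hF i)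

open Classical in
theorem measurable_resolventOp_single_apply (hα : ‖op α‖ ≤ 1) (hz : 1 < ‖z‖) (k l : sites a b)
    (v : Fib L) : Measurable fun ω => resolventOp α bl br a b ω z (lp.single 2 l v) k :=
  measurable_apply_of_smul_zipper_add hα (c := z⁻¹)
    (by rw [norm_inv]; exact inv_lt_one_of_one_lt₀ hz) (fun _ => measurable_const)
    (fun _ => inv_smul_zipper_resolventOp_add hα hz.ne' (norm_ne_zero_iff.1 (by linarith)) _) k

open Classical in
theorem measurable_star_resolventOp_single_apply (hα : ‖op α‖ ≤ 1) (hz : ‖z‖ < 1)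
    (k l : sites a b) (v : Fib L) :
    Measurable fun ω => star (resolventOp α bl br a b ω z) (lp.single 2 k v) l :=
  measurable_apply_of_smul_zipper_add hα (c := star z) (by rwa [norm_star])
    (measurable_zipper_apply α bl br (F := fun _ => lp.single 2 k v) fun _ => measurable_const)
    (fun _ => star_smul_zipper_star_resolventOp_add hα hz.ne _) l

theorem measurable_op_green (hα : ‖op α‖ ≤ 1) (hz : ‖z‖ ≠ 1) (k l : sites a b) :
    Measurable fun ω => op (green α bl br a b ω z k l) := by
  rcases lt_or_gt_of_ne hz with hlt | hgt
  · have hadj : Measurable fun ω => op (green α bl br a b ω z k l).conjTranspose :=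
      measurable_of_forall_apply fun v => by
        simp only [op_conjTranspose_green_apply]
        exact measurable_star_resolventOp_single_apply hα hlt k l v
    have hstar (ω : Sample L) : op (green α bl br a b ω z k l) =
        star (op (green α bl br a b ω z k l).conjTranspose) := by
      rw [op_conjTranspose, star_star]
    simp only [hstar]
    exact measurable_star_continuousLinearMap.comp hadj
  · refine measurable_of_forall_apply fun v => ?_
    simp only [op_green_apply]
    exact measurable_resolventOp_single_apply hα hgt k l v

end Measurability

/-! ### Fractional moments between sites carrying a random angle -/

section Interior

open scoped ENNReal

theorem finsetSum_rpow_le {ι : Type*} (t : Finset ι) (f : ι → ℝ≥0∞) {s : ℝ} (h0 : 0 < s)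
    (h1 : s ≤ 1) : (∑ i ∈ t, f i) ^ s ≤ ∑ i ∈ t, f i ^ s :=
  Finset.le_sum_of_subadditive (· ^ s) (ENNReal.zero_rpow_of_pos h0).le
    (fun x y => ENNReal.rpow_add_le_add_rpow x y h0.le h1) t f

theorem norm_le_sum_norm_inner {ι κ E F : Type*} [Fintype ι] [Fintype κ]
    [NormedAddCommGroup E] [InnerProductSpace ℂ E] [NormedAddCommGroup F] [InnerProductSpace ℂ F]
    (b : OrthonormalBasis ι ℂ F) (c : OrthonormalBasis κ ℂ E) (T : E →L[ℂ] F) :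
    ‖T‖ ≤ ∑ i, ∑ j, ‖inner ℂ (b i) (T (c j))‖ := by
  refine T.opNorm_le_bound (by positivity) fun v => ?_
  have hcol (j : κ) : ‖T (c j)‖ ≤ ∑ i, ‖inner ℂ (b i) (T (c j))‖ := by
    conv_lhs => rw [← b.sum_repr' (T (c j))]
    refine (norm_sum_le _ _).trans_eq (Finset.sum_congr rfl fun i _ => ?_)
    rw [norm_smul, b.norm_eq_one, mul_one]
  have hcoeff (j : κ) : ‖inner ℂ (c j) v‖ ≤ ‖v‖ := by
    simpa using norm_inner_le_norm (c j) v
  calc ‖T v‖ = ‖∑ j, inner ℂ (c j) v • T (c j)‖ := by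
        conv_lhs => rw [← c.sum_repr' v, map_sum]
        simp only [map_smul]
    _ ≤ ∑ j, ‖v‖ * ∑ i, ‖inner ℂ (b i) (T (c j))‖ :=
        norm_sum_le_of_le _ fun j _ => by rw [norm_smul]; gcongr; exacts [hcoeff j, hcol j]
    _ = (∑ i, ∑ j, ‖inner ℂ (b i) (T (c j))‖) * ‖v‖ := by
        rw [← Finset.mul_sum, Finset.sum_comm, mul_comm]

variable {L : ℕ} {α : Matrix (Fin L) (Fin L) ℂ} {I : Set ℤ}

theorem norm_frameVec (ω : Sample L) (k : I) (p : Fin L) : ‖frameVec ω k p‖ = 1 := by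
  rw [frameVec, lp.norm_single (by norm_num)]
  exact (Unitary.norm_map ⟨_, op_coe_mem_unitary (frame ω k)⟩ _).trans (by simp)

theorem inner_frameVec_of_ne (ω : Sample L) {k l : I} (h : k ≠ l) (p q : Fin L) :
    inner ℂ (frameVec ω k p) (frameVec ω l q) = (0 : ℂ) := by
  rw [frameVec, lp.inner_single_left, frameVec, lp.single_apply_ne _ _ _ h, inner_zero_right]

/-- The orthonormal basis of `ℂ^L` formed by the columns of `frame ω k`. -/
noncomputable def frameBasis (ω : Sample L) (k : ℤ) : OrthonormalBasis (Fin L) ℂ (Fib L) :=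
  (EuclideanSpace.basisFun (Fin L) ℂ).map
    (Unitary.linearIsometryEquiv ⟨_, op_coe_mem_unitary (frame ω k)⟩)

open Classical in
theorem frameVec_eq_single (ω : Sample L) (k : I) (p : Fin L) :
    frameVec ω k p = lp.single 2 k (frameBasis ω k p) := by
  rw [frameVec, frameBasis, OrthonormalBasis.map_apply, EuclideanSpace.basisFun_apply]
  rfl

theorem measurable_frameBasis (k : ℤ) (p : Fin L) :
    Measurable fun ω : Sample L => frameBasis ω k p := by
  simp only [frameBasis, OrthonormalBasis.map_apply, EuclideanSpace.basisFun_apply]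
  exact (measurable_op_frame k).apply_continuousLinearMap _

variable {bl br : UL L} {a b : WithBot (WithTop ℤ)} {z : ℂ} {k l : sites a b}

theorem inner_frameVec_resolventOp (ω : Sample L) (p q : Fin L) :
    inner ℂ (frameVec ω k p) (resolventOp α bl br a b ω z (frameVec ω l q)) =
      inner ℂ (frameBasis ω k p) (op (green α bl br a b ω z k l) (frameBasis ω l q)) := by
  rw [op_green_apply, frameVec_eq_single, frameVec_eq_single, lp.inner_single_left]

theorem measurable_inner_frameVec_resolventOp (hα : ‖op α‖ ≤ 1) (hz : ‖z‖ ≠ 1) (p q : Fin L) :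
    Measurable fun ω => (inner ℂ (frameVec ω k p)
      (resolventOp α bl br a b ω z (frameVec ω l q)) : ℂ) := by
  simp only [inner_frameVec_resolventOp]
  exact (measurable_frameBasis k p).inner (ContinuousLinearMap.measurable_apply₂.comp
    ((measurable_op_green hα hz k l).prodMk (measurable_frameBasis l q)))

theorem exists_linePhase_resolvent_setAngle (hα : ‖op α‖ ≤ 1) (hz : ‖z‖ ≠ 1) (hkl : k ≠ l)
    (hk : (k : ℤ) - 1 ∈ sites a b) (hl : (l : ℤ) - 1 ∈ sites a b) (p q : Fin L) (ω : Sample L)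
    (θ η : Set.Icc (0 : ℝ) (2 * Real.pi)) :
    ∃ φ, linePhase (frameVec ω k p) (phase θ) (linePhase (frameVec ω l q) (phase η)
        (zipper α bl br a b (setAngle l q zeroAngle (setAngle k p zeroAngle ω)) φ)) - z • φ =
          frameVec ω l q ∧
      ‖(inner ℂ (frameVec ω k p) φ : ℂ)‖ = ‖(inner ℂ (frameVec ω k p) (resolventOp α bl br a b
        (setAngle k p θ (setAngle l q η ω)) z (frameVec ω l q)) : ℂ)‖ := by
  have hψ := zipper_resolventOp (bl := bl) (br := br) (a := a) (b := b)
    (ω := setAngle k p θ (setAngle l q η ω)) hα hz (frameVec ω l q)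
  rw [zipper_setAngle hk, setAngle_comm (Subtype.coe_injective.ne hkl), zipper_setAngle hl,
    frameVec_setAngle, frameVec_setAngle] at hψ
  have hnorm (P : Prop) [Decidable P] (t : Set.Icc (0 : ℝ) (2 * Real.pi)) :
      ‖if P then 1 else phase t‖ = 1 := by split_ifs <;> simp [norm_phase]
  have hmul (P : Prop) [Decidable P] (u : ℂ) :
      (if P then u else 1) * (if P then 1 else u) = u := by split_ifs <;> simp
  simpa only [hmul] using exists_linePhase_left (norm_frameVec ω k p) (norm_frameVec ω l q)
    (inner_frameVec_of_ne ω hkl p q) (hnorm _ θ) (hnorm _ η) hψ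

variable {s p : ℝ} (hs : 0 < s) (hp0 : 0 ≤ p) (hp1 : p ≤ 1) (hα : ‖op α‖ ≤ 1)
  (hz : ‖z‖ ≠ 1) (hkl : k ≠ l) (hk : (k : ℤ) - 1 ∈ sites a b) (hl : (l : ℤ) - 1 ∈ sites a b)

include hs hp0 hp1 hα hz hkl hk hl

theorem lintegral_inner_frameVec_le (m n : Fin L) :
    ∫⁻ ω, ‖z * inner ℂ (frameVec ω k m) (resolventOp α bl br a b ω z (frameVec ω l n))‖ₑ ^ s
      ∂(law L p) ≤ circleMoment s ^ 2 := by
  refine lintegral_law_le_of_setAngle k l m n hp0 hp1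
    (((measurable_inner_frameVec_resolventOp hα hz m n).const_mul z).enorm.pow_const s)
    fun ω => ?_
  choose φ hφ hinner using exists_linePhase_resolvent_setAngle (bl := bl) (br := br) hα hz hkl hk
    hl m n ω
  simp only [frameVec_setAngle, enorm_mul, ← enorm_norm (inner ℂ _ _), ← hinner]
  simpa only [enorm_mul, enorm_norm] using lintegral_inner_resolvent_linePhase_le hs
    (zipper_mem_unitary hα bl br a b _) (norm_frameVec ω k m) (norm_frameVec ω l n)
    (inner_frameVec_of_ne ω hkl m n) hz φ hφ

theorem lintegral_mul_op_green_le (hs1 : s ≤ 1) :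
    ∫⁻ ω, (‖z‖ₑ * ‖op (green α bl br a b ω z k l)‖ₑ) ^ s ∂(law L p) ≤
      L ^ 2 * circleMoment s ^ 2 := by
  set g : Fin L → Fin L → Sample L → ℂ := fun m n ω =>
    z * inner ℂ (frameVec ω k m) (resolventOp α bl br a b ω z (frameVec ω l n)) with hg
  have hmeas (m n : Fin L) : Measurable fun ω => ‖g m n ω‖ₑ ^ s :=
    ((measurable_inner_frameVec_resolventOp hα hz m n).const_mul z).enorm.pow_const s
  have pointwise (ω : Sample L) : (‖z‖ₑ * ‖op (green α bl br a b ω z k l)‖ₑ) ^ s ≤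
      ∑ m, ∑ n, ‖g m n ω‖ₑ ^ s := by
    refine (ENNReal.rpow_le_rpow ?_ hs.le).trans ((finsetSum_rpow_le _ _ hs hs1).trans
      (Finset.sum_le_sum fun m _ => finsetSum_rpow_le _ _ hs hs1))
    have hnorm := norm_le_sum_norm_inner (frameBasis ω k) (frameBasis ω l)
      (op (green α bl br a b ω z k l))
    simp only [hg, inner_frameVec_resolventOp, enorm_mul, ← Finset.mul_sum]
    gcongr
    simpa only [enorm_eq_nnnorm, ← ENNReal.ofNNReal_finsetSum, ENNReal.coe_le_coe,
      ← NNReal.coe_le_coe, NNReal.coe_sum, coe_nnnorm] using hnorm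
  calc _ ≤ ∫⁻ ω, ∑ m, ∑ n, ‖g m n ω‖ₑ ^ s ∂(law L p) := lintegral_mono pointwise
    _ = ∑ m, ∑ n, ∫⁻ ω, ‖g m n ω‖ₑ ^ s ∂(law L p) := by
        rw [lintegral_finsetSum _ fun m _ => Finset.measurable_fun_sum _ fun n _ => hmeas m n]
        exact Finset.sum_congr rfl fun m _ => lintegral_finsetSum _ fun n _ => hmeas m n
    _ ≤ ∑ _m : Fin L, ∑ _n : Fin L, circleMoment s ^ 2 :=
        Finset.sum_le_sum fun m _ => Finset.sum_le_sum fun n _ =>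
          lintegral_inner_frameVec_le hs hp0 hp1 hα hz hkl hk hl m n
    _ = L ^ 2 * circleMoment s ^ 2 := by simp; ring

end Interior

/-! ### Removing the boundary conditions -/

section Layer

variable {L : ℕ} {α : Matrix (Fin L) (Fin L) ℂ} {bl br : UL L} {I : Set ℤ} {ω : Sample L} {r : ℤ}
  {i : I} (f : Hil L I)

theorem norm_op_coe_apply (u : UL L) (v : Fib L) : ‖op (u : Matrix (Fin L) (Fin L) ℂ) v‖ = ‖v‖ :=
  Unitary.norm_map ⟨_, op_coe_mem_unitary u⟩ v

theorem norm_layer_apply_of_notMem (hi : mate r i ∉ I) :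
    ‖layer α bl br I ω r f i‖ = ‖f i‖ := by
  obtain ⟨u, hu⟩ := exists_layerDiag_eq_of_notMem (α := α) (bl := bl) (br := br) (ω := ω) hi
  rw [layer_apply, layerOff_of_notMem hi, hu, op, op, map_zero, zero_apply, add_zero]
  exact norm_op_coe_apply u _

theorem norm_star_layer_apply_of_notMem (hi : mate r i ∉ I) :
    ‖star (layer α bl br I ω r) f i‖ = ‖f i‖ := by
  obtain ⟨u, hu⟩ := exists_layerDiag_eq_of_notMem (α := α) (bl := bl) (br := br) (ω := ω) hi
  rw [star_layer_apply, mateIn_of_notMem hi, layerOff_of_notMem hi, hu,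
    Matrix.conjTranspose_zero, op, op, map_zero, zero_apply, add_zero]
  exact norm_op_coe_apply u⁻¹ _

theorem norm_layer_apply_le_of_even (hα : ‖op α‖ ≤ 1) (hi : mate r i ∈ I)
    (h : Even ((i : ℤ) - r)) :
    ‖layer α bl br I ω r f i‖ ≤ ‖op α‖ * ‖f i‖ + ‖f (mateIn r i)‖ := by
  rw [layer_apply, layerDiag_of_even hi h, layerOff_of_even hi h, blockB]
  refine (norm_add_le _ _).trans (add_le_add ((op α).le_opNorm _) ?_)
  simpa using (op _).le_of_opNorm_le ((norm_op_mul_unitary _ _).trans_le (norm_op_rho_le_one hα)) _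

theorem norm_star_layer_apply_le_of_even (hα : ‖op α‖ ≤ 1) (hi : mate r i ∈ I)
    (h : Even ((i : ℤ) - r)) :
    ‖star (layer α bl br I ω r) f i‖ ≤ ‖op α‖ * ‖f i‖ + ‖f (mateIn r i)‖ := by
  have hm : mate r (mateIn r i) ∈ I := by rw [mateIn_of_mem hi, mate_mate]; exact i.2
  have hodd : ¬Even ((mateIn r i : ℤ) - r) := by rwa [mateIn_of_mem hi, not_even_mate_sub]
  rw [star_layer_apply, layerDiag_of_even hi h, layerOff_of_not_even hm hodd, blockC]
  refine (norm_add_le _ _).trans (add_le_add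
    ((op _).le_of_opNorm_le (norm_op_conjTranspose α).le _) ?_)
  simpa using (op _).le_of_opNorm_le ((norm_op_conjTranspose _).trans_le
    ((norm_op_unitary_mul _ _).trans_le (norm_op_rhoT_le_one hα))) _

theorem mul_norm_apply_le_norm_apply_add_one (hα : ‖op α‖ ≤ 1) {k k' : I}
    (hk : (k : ℤ) - 1 ∉ I) (hk' : (k' : ℤ) = k + 1) {w : ℂ} {r : ℝ} (hr : r ≤ ‖w‖)
    (hr' : ‖w‖ * r ≤ 1) {f : Hil L I}
    (hf : layer α bl br I ω 1 f k = w • star (layer α bl br I ω 0) f k) :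
    (r - ‖op α‖) * ‖f k‖ ≤ ‖f k'‖ := by
  rw [sub_mul, sub_le_iff_le_add']
  have hnorm := congrArg norm hf
  rw [norm_smul] at hnorm
  have hmateIn {r : ℤ} (hmem : mate r k ∈ I) (h : Even ((k : ℤ) - r)) : mateIn r k = k' :=
    Subtype.ext ((coe_mateIn_of_even hmem h).trans hk'.symm)
  by_cases heven : Even (k : ℤ)
  · have h0 : Even ((k : ℤ) - 0) := by simpa using heven
    have hcut : mate 1 (k : ℤ) ∉ I := by rwa [mate_of_not_even (by grind)]
    have hmem : mate 0 (k : ℤ) ∈ I := by rw [mate_of_even h0, ← hk']; exact k'.2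
    rw [norm_layer_apply_of_notMem f hcut] at hnorm
    calc r * ‖f k‖ = ‖w‖ * r * ‖star (layer α bl br I ω 0) f k‖ := by rw [hnorm]; ring
      _ ≤ ‖star (layer α bl br I ω 0) f k‖ := mul_le_of_le_one_left (norm_nonneg _) hr'
      _ ≤ ‖op α‖ * ‖f k‖ + ‖f k'‖ := by
        simpa only [hmateIn hmem h0] using norm_star_layer_apply_le_of_even f hα hmem h0
  · have h1 : Even ((k : ℤ) - 1) := by grind
    have hcut : mate 0 (k : ℤ) ∉ I := by rwa [mate_of_not_even (by simpa using heven)]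
    have hmem : mate 1 (k : ℤ) ∈ I := by rw [mate_of_even h1, ← hk']; exact k'.2
    rw [norm_star_layer_apply_of_notMem f hcut] at hnorm
    calc r * ‖f k‖ ≤ ‖layer α bl br I ω 1 f k‖ := by rw [hnorm]; gcongr
      _ ≤ ‖op α‖ * ‖f k‖ + ‖f k'‖ := by
        simpa only [hmateIn hmem h1] using norm_layer_apply_le_of_even f hα hmem h1

theorem abs_sub_mateIn_le_one (r : ℤ) (i : I) : |(i : ℤ) - mateIn r i| ≤ 1 := by
  by_cases hi : mate r i ∈ I
  · by_cases h : Even ((i : ℤ) - r)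
    · simp [mateIn_of_mem hi, mate_of_even h]
    · simp [mateIn_of_mem hi, mate_of_not_even h]
  · simp [mateIn_of_notMem hi]

theorem ne_of_one_lt_abs_sub {k l : I} (h : 1 < |(k : ℤ) - l|) : k ≠ l := by
  rintro rfl
  simp at h

theorem mateIn_ne_of_one_lt_abs_sub {k l : I} (h : 1 < |(k : ℤ) - l|) : mateIn r k ≠ l := by
  rintro rfl
  exact h.not_ge (abs_sub_mateIn_le_one r k)

open Classical in
theorem layer_single_apply_eq_zero {k l : I} (h : 1 < |(k : ℤ) - l|) (v : Fib L) :
    layer α bl br I ω r (lp.single 2 l v) k = 0 := by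
  rw [layer_apply, lp.single_apply_ne _ _ _ (ne_of_one_lt_abs_sub h),
    lp.single_apply_ne _ _ _ (mateIn_ne_of_one_lt_abs_sub h), map_zero, map_zero, add_zero]

open Classical in
theorem star_layer_single_apply_eq_zero {k l : I} (h : 1 < |(k : ℤ) - l|) (v : Fib L) :
    star (layer α bl br I ω r) (lp.single 2 l v) k = 0 := by
  rw [star_layer_apply, lp.single_apply_ne _ _ _ (ne_of_one_lt_abs_sub h),
    lp.single_apply_ne _ _ _ (mateIn_ne_of_one_lt_abs_sub h), map_zero, map_zero, add_zero]

end Layer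

section Boundary

variable {L : ℕ} {α : Matrix (Fin L) (Fin L) ℂ} {bl br : UL L} {a b : WithBot (WithTop ℤ)}
  {ω : Sample L} {z : ℂ} {k l : sites a b}

theorem layer_one_resolventOp (hα : ‖op α‖ ≤ 1) (hz : ‖z‖ ≠ 1) (f : Hil L (sites a b)) :
    layer α bl br (sites a b) ω 1 (resolventOp α bl br a b ω z f) =
      z • star (layer α bl br (sites a b) ω 0) (resolventOp α bl br a b ω z f) +
        star (layer α bl br (sites a b) ω 0) f := by
  set ψ := resolventOp α bl br a b ω z f
  have hsolve : zipper α bl br a b ω ψ - z • ψ = f := zipper_resolventOp hα hz f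
  rw [← map_smul, ← map_add, ← hsolve, add_sub_cancel]
  exact (DFunLike.congr_fun (Unitary.star_mul_self_of_mem
    (layer_mem_unitary hα bl br (sites a b) ω 0)) _).symm

theorem star_layer_zero_star_resolventOp (hα : ‖op α‖ ≤ 1) (hz : ‖z‖ ≠ 1)
    (f : Hil L (sites a b)) :
    star (layer α bl br (sites a b) ω 0) (star (resolventOp α bl br a b ω z) f) =
      star z • layer α bl br (sites a b) ω 1 (star (resolventOp α bl br a b ω z) f) +
        layer α bl br (sites a b) ω 1 f := by
  set φ := star (resolventOp α bl br a b ω z) f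
  have hsolve : star (zipper α bl br a b ω) φ - star z • φ = f :=
    star_zipper_star_resolventOp hα hz f
  have hstar : star (zipper α bl br a b ω) = star (layer α bl br (sites a b) ω 1) *
      star (layer α bl br (sites a b) ω 0) := star_mul _ _
  rw [← map_smul, ← map_add, ← hsolve, add_sub_cancel, hstar]
  exact (DFunLike.congr_fun (Unitary.mul_star_self_of_mem
    (layer_mem_unitary hα bl br (sites a b) ω 1)) _).symm

theorem ordConnected_sites : (sites a b).OrdConnected :=
  ⟨fun _ hm _ hn _ hi =>
    ⟨hm.1.trans (by exact_mod_cast hi.1), le_trans (by exact_mod_cast hi.2) hn.2⟩⟩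

theorem add_one_lt_of_sub_one_notMem (hkl : 1 < |(k : ℤ) - l|) (hk : (k : ℤ) - 1 ∉ sites a b) :
    (k : ℤ) + 1 < l := by
  by_contra! hle
  exact hk (ordConnected_sites.out l.2 k.2 ⟨by grind, by lia⟩)

variable {r : ℝ} (hα : ‖op α‖ ≤ 1) (hαr : ‖op α‖ < r) (hz : ‖z‖ ≠ 1) (hr : r ≤ ‖z‖)
  (hr' : ‖z‖ * r ≤ 1)

include hα hαr hz hr hr'

theorem norm_op_green_le_of_row (hkl : 1 < |(k : ℤ) - l|) (hk : (k : ℤ) - 1 ∉ sites a b)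
    {k' : sites a b} (hk' : (k' : ℤ) = k + 1) :
    ‖op (green α bl br a b ω z k l)‖ ≤
      (r - ‖op α‖)⁻¹ * ‖op (green α bl br a b ω z k' l)‖ := by
  classical
  have hpos : 0 < r - ‖op α‖ := sub_pos.2 hαr
  refine ContinuousLinearMap.opNorm_le_bound _ (by positivity) fun v => ?_
  have hψ := congrArg (fun f : Hil L (sites a b) => f k)
    (layer_one_resolventOp (bl := bl) (br := br) (ω := ω) hα hz (lp.single 2 l v))
  simp only [lp.coeFn_add, lp.coeFn_smul, Pi.add_apply, Pi.smul_apply,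
    star_layer_single_apply_eq_zero hkl, add_zero] at hψ
  have hle := mul_norm_apply_le_norm_apply_add_one hα hk hk' hr hr' hψ
  rw [← op_green_apply, ← op_green_apply] at hle
  rw [mul_assoc, le_inv_mul_iff₀ hpos]
  exact hle.trans ((op _).le_opNorm v)

theorem norm_op_green_le_of_column (hkl : 1 < |(k : ℤ) - l|) (hl : (l : ℤ) - 1 ∉ sites a b)
    {l' : sites a b} (hl' : (l' : ℤ) = l + 1) :
    ‖op (green α bl br a b ω z k l)‖ ≤
      (r - ‖op α‖)⁻¹ * ‖op (green α bl br a b ω z k l')‖ := by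
  classical
  have hpos : 0 < r - ‖op α‖ := sub_pos.2 hαr
  have hz0 : 0 < ‖z‖ := (norm_nonneg _).trans_lt (hαr.trans_le hr)
  have hw : r ≤ ‖(star z)⁻¹‖ := by
    rwa [norm_inv, norm_star, ← one_div, le_div_iff₀ hz0, mul_comm]
  have hw' : ‖(star z)⁻¹‖ * r ≤ 1 := by rwa [norm_inv, norm_star, inv_mul_le_iff₀ hz0, mul_one]
  rw [← norm_op_conjTranspose, ← norm_op_conjTranspose (green α bl br a b ω z k l')]
  refine ContinuousLinearMap.opNorm_le_bound _ (by positivity) fun v => ?_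
  have hφ := congrArg (fun f : Hil L (sites a b) => (star z)⁻¹ • f l)
    (star_layer_zero_star_resolventOp (bl := bl) (br := br) (ω := ω) hα hz (lp.single 2 k v))
  simp only [lp.coeFn_add, lp.coeFn_smul, Pi.add_apply, Pi.smul_apply,
    layer_single_apply_eq_zero (abs_sub_comm (k : ℤ) l ▸ hkl), add_zero,
    inv_smul_smul₀ (star_ne_zero.2 (norm_pos_iff.1 hz0))] at hφ
  have hle := mul_norm_apply_le_norm_apply_add_one hα hl hl' hw hw' hφ.symm
  rw [← op_conjTranspose_green_apply, ← op_conjTranspose_green_apply] at hle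
  rw [mul_assoc, le_inv_mul_iff₀ hpos]
  exact hle.trans ((op _).le_opNorm v)

theorem exists_norm_op_green_le (hkl : 1 < |(k : ℤ) - l|) :
    ∃ k' l' : sites a b, k' ≠ l' ∧ (k' : ℤ) - 1 ∈ sites a b ∧ (l' : ℤ) - 1 ∈ sites a b ∧
      ∀ ω, ‖op (green α bl br a b ω z k l)‖ ≤
        (r - ‖op α‖)⁻¹ * ‖op (green α bl br a b ω z k' l')‖ := by
  by_cases hk : (k : ℤ) - 1 ∈ sites a b
  · by_cases hl : (l : ℤ) - 1 ∈ sites a b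
    · have hr1 : r ≤ 1 := by nlinarith [norm_nonneg (op α)]
      refine ⟨k, l, ne_of_one_lt_abs_sub hkl, hk, hl, fun ω => ?_⟩
      exact le_mul_of_one_le_left (norm_nonneg _)
        ((one_le_inv₀ (sub_pos.2 hαr)).2 (by linarith [norm_nonneg (op α)]))
    · have hlt := add_one_lt_of_sub_one_notMem (abs_sub_comm (k : ℤ) l ▸ hkl) hl
      refine ⟨k, ⟨l + 1, ordConnected_sites.out l.2 k.2 ⟨by lia, by lia⟩⟩,
        fun h => hlt.ne (congrArg Subtype.val h).symm, hk, by simp, fun ω => ?_⟩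
      exact norm_op_green_le_of_column hα hαr hz hr hr' hkl hl rfl
  · have hlt := add_one_lt_of_sub_one_notMem hkl hk
    refine ⟨⟨k + 1, ordConnected_sites.out k.2 l.2 ⟨by lia, by lia⟩⟩, l,
      fun h => hlt.ne (congrArg Subtype.val h), by simp,
      ordConnected_sites.out k.2 l.2 ⟨by lia, by lia⟩, fun ω => ?_⟩
    exact norm_op_green_le_of_row hα hαr hz hr hr' hkl hk rfl

end Boundary

/-! ### Subordinate norms -/

theorem continuous_seminorm {E : Type*} [NormedAddCommGroup E] [NormedSpace ℂ E]
    [FiniteDimensional ℂ E] (q : Seminorm ℂ E) : Continuous q := by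
  have : FiniteDimensional ℝ E := FiniteDimensional.complexToReal E
  exact continuousOn_univ.1 (q.convexOn.continuousOn isOpen_univ)

theorem exists_mul_norm_le_seminorm {E : Type*} [NormedAddCommGroup E] [NormedSpace ℂ E]
    [FiniteDimensional ℂ E] (q : Seminorm ℂ E) (hq : ∀ x, q x = 0 → x = 0) :
    ∃ c > 0, ∀ x, c * ‖x‖ ≤ q x := by
  have pos_on_sphere : ∀ x ∈ Metric.sphere (0 : E) 1, 0 < q x := fun x hx =>
    (apply_nonneg q x).lt_of_ne' fun h => ne_zero_of_mem_unit_sphere ⟨x, hx⟩ (hq x h)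
  have : ProperSpace E := FiniteDimensional.proper ℂ E
  obtain ⟨c, hc, hcq⟩ := (isCompact_sphere (0 : E) 1).exists_forall_le'
    (continuous_seminorm q).continuousOn pos_on_sphere
  refine ⟨c, hc, fun x => ?_⟩
  rcases eq_or_ne x 0 with rfl | hx
  · simp
  have hx' := hcq ((‖x‖⁻¹ : ℂ) • x) (by simpa using norm_smul_inv_norm (𝕜 := ℂ) hx)
  rwa [map_smul_eq_mul, norm_inv, Complex.norm_real, norm_norm, inv_mul_eq_div,
    le_div_iff₀ (norm_pos_iff.2 hx)] at hx'

section SubordinateNorm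

variable {L : ℕ} {N : Seminorm ℂ (Fin L → ℂ)}

theorem subordinateNorm_nonneg (N : Seminorm ℂ (Fin L → ℂ)) (A : Matrix (Fin L) (Fin L) ℂ) :
    0 ≤ subordinateNorm N A :=
  Real.sSup_nonneg (Set.forall_mem_image.2 fun _ _ => apply_nonneg _ _)

variable (hN : ∀ x, N x = 0 → x = 0)

include hN

theorem bddAbove_image_mulVec (A : Matrix (Fin L) (Fin L) ℂ) :
    BddAbove ((fun x => N (A.mulVec x)) '' {x | N x ≤ 1}) := by
  obtain ⟨c, hc, hcN⟩ := exists_mul_norm_le_seminorm N hN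
  have hsub : {x | N x ≤ 1} ⊆ Metric.closedBall 0 c⁻¹ := fun x hx => by
    rw [mem_closedBall_zero_iff, ← one_div, le_div_iff₀' hc]
    exact (hcN x).trans hx
  exact ((isCompact_closedBall _ _).bddAbove_image
    ((continuous_seminorm N).comp (by fun_prop)).continuousOn).mono (Set.image_mono hsub)

/-- The subordinate norm as a seminorm on matrices, so that its continuity and its comparison with
the operator norm come from the finite dimension. -/
noncomputable def subordinateSeminorm : Seminorm ℂ (Matrix (Fin L) (Fin L) ℂ) :=
  Seminorm.of (subordinateNorm N)
    (fun A B => by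
      refine Real.sSup_le (Set.forall_mem_image.2 fun x hx => ?_)
        (add_nonneg (subordinateNorm_nonneg N A) (subordinateNorm_nonneg N B))
      rw [Matrix.add_mulVec]
      exact (map_add_le_add N _ _).trans
        (add_le_add (le_csSup (bddAbove_image_mulVec hN A) (Set.mem_image_of_mem _ hx))
          (le_csSup (bddAbove_image_mulVec hN B) (Set.mem_image_of_mem _ hx))))
    (fun c A => by
      rw [subordinateNorm, subordinateNorm, ← smul_eq_mul,
        ← Real.sSup_smul_of_nonneg (norm_nonneg c), ← Set.image_smul, Set.image_image]
      simp only [Matrix.smul_mulVec, map_smul_eq_mul, smul_eq_mul])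

theorem exists_continuous_seminorm_op_eq_subordinateNorm :
    ∃ q : Seminorm ℂ (Fib L →L[ℂ] Fib L), Continuous q ∧ ∀ A, q (op A) = subordinateNorm N A :=
  let e := (Matrix.toEuclideanCLM (n := Fin L) (𝕜 := ℂ)).symm
  let f : (Fib L →L[ℂ] Fib L) →ₗ[ℂ] Matrix (Fin L) (Fin L) ℂ :=
    { toFun := e, map_add' := map_add e, map_smul' := map_smul e }
  ⟨(subordinateSeminorm hN).comp f, continuous_seminorm _, fun A =>
    congrArg (subordinateNorm N) (Matrix.toEuclideanCLM.symm_apply_apply A)⟩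

theorem exists_subordinateNorm_le : ∃ M > 0, ∀ A, subordinateNorm N A ≤ M * ‖op A‖ := by
  obtain ⟨q, hq, hqN⟩ := exists_continuous_seminorm_op_eq_subordinateNorm hN
  obtain ⟨M, hM, hMq⟩ := Seminorm.bound_of_continuous_normedSpace q hq
  exact ⟨M, hM, fun A => hqN A ▸ hMq (op A)⟩

theorem measurable_subordinateNorm {Ω : Type*} [MeasurableSpace Ω]
    {A : Ω → Matrix (Fin L) (Fin L) ℂ} (hA : Measurable fun ω => op (A ω)) :
    Measurable fun ω => subordinateNorm N (A ω) := by
  obtain ⟨q, hq, hqN⟩ := exists_continuous_seminorm_op_eq_subordinateNorm hN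
  simpa only [Function.comp_def, hqN] using hq.measurable.comp hA

end SubordinateNorm

/-! ### Uniform bounds for fractional moments -/

section FractionalMoments

variable {Ω : Type*} [MeasurableSpace Ω] {μ : Measure Ω}

theorem lintegral_enorm_rpow_le_of_norm_le_mul {E F : Type*} [SeminormedAddCommGroup E]
    [SeminormedAddCommGroup F] {f : Ω → E} {g : Ω → F} {K s : ℝ} (hK : 0 ≤ K) (hs : 0 ≤ s)
    (h : ∀ ω, ‖f ω‖ ≤ K * ‖g ω‖) :
    ∫⁻ ω, ‖f ω‖ₑ ^ s ∂μ ≤ ENNReal.ofReal K ^ s * ∫⁻ ω, ‖g ω‖ₑ ^ s ∂μ := by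
  rw [← lintegral_const_mul' _ _ (ENNReal.rpow_ne_top_of_nonneg hs ENNReal.ofReal_ne_top)]
  refine lintegral_mono fun ω => ?_
  rw [← ENNReal.mul_rpow_of_nonneg _ _ hs, ← ofReal_norm (f ω), ← ofReal_norm (g ω),
    ← ENNReal.ofReal_mul hK]
  exact ENNReal.rpow_le_rpow (ENNReal.ofReal_le_ofReal (h ω)) hs

theorem integrable_and_integral_le_of_lintegral_enorm_le {f : Ω → ℝ} {C : ENNReal}
    (hf : AEStronglyMeasurable f μ) (hC : C ≠ ⊤) (h : ∫⁻ ω, ‖f ω‖ₑ ∂μ ≤ C) :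
    Integrable f μ ∧ ∫ ω, f ω ∂μ ≤ C.toReal := by
  refine ⟨⟨hf, h.trans_lt hC.lt_top⟩, (le_abs_self _).trans ?_⟩
  rw [← Real.norm_eq_abs, ← toReal_enorm]
  exact ENNReal.toReal_mono hC ((enorm_integral_le_lintegral_enorm f).trans h)

end FractionalMoments

section UniformBounds

open scoped ENNReal

variable {L : ℕ} {α : Matrix (Fin L) (Fin L) ℂ} {bl br : UL L} {a b : WithBot (WithTop ℤ)} {z : ℂ}
  {k l : sites a b} {r s p : ℝ}

theorem norm_op_green_le (hα : ‖op α‖ ≤ 1) (hz : ‖z‖ ≠ 1) (ω : Sample L) :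
    ‖op (green α bl br a b ω z k l)‖ ≤ |‖z‖ - 1|⁻¹ := by
  refine ContinuousLinearMap.opNorm_le_bound _ (by positivity) fun v => ?_
  classical
  rw [op_green_apply, inv_mul_eq_div, le_div_iff₀' (abs_pos.2 (sub_ne_zero.2 hz))]
  set ψ := resolventOp α bl br a b ω z (lp.single 2 l v)
  have hnorm : ‖zipper α bl br a b ω ψ‖ = ‖ψ‖ :=
    Unitary.norm_map ⟨_, zipper_mem_unitary hα bl br a b ω⟩ ψ
  calc |‖z‖ - 1| * ‖ψ k‖ ≤ |‖z‖ - 1| * ‖ψ‖ := by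
        gcongr
        exact lp.norm_apply_le_norm (by norm_num) ψ k
    _ = |‖zipper α bl br a b ω ψ‖ - ‖z • ψ‖| := by
        rw [hnorm, norm_smul, abs_sub_comm (‖ψ‖), ← sub_one_mul, abs_mul, abs_norm]
    _ ≤ ‖zipper α bl br a b ω ψ - z • ψ‖ := abs_norm_sub_norm_le _ _
    _ = ‖v‖ := by rw [zipper_resolventOp hα hz, lp.norm_single (by norm_num)]

variable (hs : 0 < s) (hp0 : 0 ≤ p) (hp1 : p ≤ 1) (hα : ‖op α‖ ≤ 1)

include hs hp0 hp1 hα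

theorem lintegral_op_green_le_of_far (hr : r < 1) (hz : 1 - r ≤ |‖z‖ - 1|) :
    ∫⁻ ω, ‖op (green α bl br a b ω z k l)‖ₑ ^ s ∂(law L p) ≤ ENNReal.ofReal (1 - r)⁻¹ ^ s := by
  have := isProbabilityMeasure_law L hp0 hp1
  have hr' : 0 < 1 - r := sub_pos.2 hr
  have hz1 : ‖z‖ ≠ 1 := fun h => by norm_num [h] at hz; linarith
  have hle (ω : Sample L) : ‖op (green α bl br a b ω z k l)‖ ≤ (1 - r)⁻¹ * ‖(1 : ℝ)‖ := by
    rw [norm_one, mul_one]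
    exact (norm_op_green_le hα hz1 ω).trans (inv_anti₀ hr' hz)
  simpa only [enorm_one, ENNReal.one_rpow, lintegral_one, measure_univ, mul_one] using
    lintegral_enorm_rpow_le_of_norm_le_mul (μ := law L p) (inv_nonneg.2 hr'.le) hs.le hle

theorem lintegral_op_green_le_of_near (hs1 : s ≤ 1) (hαr : ‖op α‖ < r) (hz : ‖z‖ ≠ 1)
    (hr : r ≤ ‖z‖) (hr' : ‖z‖ * r ≤ 1) (hkl : 1 < |(k : ℤ) - l|) :
    ∫⁻ ω, ‖op (green α bl br a b ω z k l)‖ₑ ^ s ∂(law L p) ≤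
      ENNReal.ofReal ((r - ‖op α‖)⁻¹ * r⁻¹) ^ s * (L ^ 2 * circleMoment s ^ 2) := by
  have hr0 : 0 < r := (norm_nonneg _).trans_lt hαr
  have hgap : 0 < r - ‖op α‖ := sub_pos.2 hαr
  obtain ⟨k', l', hne, hk', hl', hle⟩ := exists_norm_op_green_le (bl := bl) (br := br) hα hαr hz hr
    hr' hkl
  have hle' (ω : Sample L) : ‖op (green α bl br a b ω z k l)‖ ≤
      (r - ‖op α‖)⁻¹ * r⁻¹ * ‖z • op (green α bl br a b ω z k' l')‖ := by
    rw [norm_smul, mul_assoc, ← mul_assoc r⁻¹]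
    refine (hle ω).trans (mul_le_mul_of_nonneg_left ?_ (inv_nonneg.2 hgap.le))
    exact le_mul_of_one_le_left (norm_nonneg _) ((one_le_inv_mul₀ hr0).2 hr)
  refine (lintegral_enorm_rpow_le_of_norm_le_mul (by positivity) hs.le hle').trans ?_
  gcongr
  simpa only [enorm_smul] using lintegral_mul_op_green_le hs hp0 hp1 hα hz hne hk' hl' hs1

end UniformBounds

theorem one_sub_le_abs_sub_one_of_not_near {x r : ℝ} (hr0 : 0 ≤ r) (hr1 : r ≤ 1)
    (h : ¬(r ≤ x ∧ x * r ≤ 1)) : 1 - r ≤ |x - 1| := by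
  by_contra! hlt
  obtain ⟨h1, h2⟩ := abs_lt.1 hlt
  exact h ⟨by linarith, by nlinarith⟩

theorem exists_lintegral_op_green_le {L : ℕ} {α : Matrix (Fin L) (Fin L) ℂ} {s p : ℝ}
    (hs0 : 0 < s) (hs1 : s < 1) (hp0 : 0 ≤ p) (hp1 : p ≤ 1) (hα : ‖op α‖ < 1) :
    ∃ C : ENNReal, C ≠ ⊤ ∧ ∀ (bl br : UL L) (z : ℂ), ‖z‖ ≠ 1 →
      ∀ (a b : WithBot (WithTop ℤ)) (k l : sites a b), 1 < |(k : ℤ) - l| →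
        ∫⁻ ω, ‖op (green α bl br a b ω z k l)‖ₑ ^ s ∂(law L p) ≤ C := by
  obtain ⟨r, hαr, hr1⟩ := exists_between hα
  have hr0 : 0 ≤ r := (norm_nonneg _).trans hαr.le
  have hpow (K : ℝ) : ENNReal.ofReal K ^ s ≠ ⊤ :=
    ENNReal.rpow_ne_top_of_nonneg hs0.le ENNReal.ofReal_ne_top
  have hcircle : (L : ENNReal) ^ 2 * circleMoment s ^ 2 ≠ ⊤ :=
    ENNReal.mul_ne_top (by simp) (ENNReal.pow_ne_top (circleMoment_ne_top hs0.le hs1))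
  refine ⟨max _ _, max_ne_top (ENNReal.mul_ne_top (hpow ((r - ‖op α‖)⁻¹ * r⁻¹)) hcircle)
    (hpow (1 - r)⁻¹), fun bl br z hz a b k l hkl => ?_⟩
  by_cases hnear : r ≤ ‖z‖ ∧ ‖z‖ * r ≤ 1
  · exact le_max_of_le_left
      (lintegral_op_green_le_of_near hs0 hp0 hp1 hα.le hs1.le hαr hz hnear.1 hnear.2 hkl)
  · exact le_max_of_le_right (lintegral_op_green_le_of_far hs0 hp0 hp1 hα.le hr1
      (one_sub_le_abs_sub_one_of_not_near hr0 hr1.le hnear))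

end ScatteringZipper

theorem mainTheorem5_general {L : ℕ} {p : ℝ} (hp0 : 0 ≤ p) (hp1 : p ≤ 1)
    {α : Matrix (Fin L) (Fin L) ℂ} (hα : ‖op α‖ < 1)
    {N : Seminorm ℂ (Fin L → ℂ)} (hN : ∀ x, N x = 0 → x = 0)
    {s : ℝ} (hs0 : 0 < s) (hs1 : s < 1) :
    ∃ C : ℝ, 0 < C ∧
      ∀ (bl br : UL L) (z : ℂ), ‖z‖ ≠ 1 →
      ∀ a b : WithBot (WithTop ℤ),
        (∀ ω : Sample L,
          IsUnit (zipper α bl br a b ω - z • ContinuousLinearMap.id ℂ (Hil L (sites a b)))) ∧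
        ∀ k l : sites a b, 1 < |(k : ℤ) - (l : ℤ)| →
          Integrable (fun ω => subordinateNorm N (green α bl br a b ω z k l) ^ s) (law L p) ∧
          ∫ ω, subordinateNorm N (green α bl br a b ω z k l) ^ s ∂(law L p) ≤ C := by
  obtain ⟨M, hM, hNM⟩ := exists_subordinateNorm_le hN
  obtain ⟨C, hC, hCle⟩ := exists_lintegral_op_green_le hs0 hs1 hp0 hp1 hα
  have htop : ENNReal.ofReal M ^ s * C ≠ ⊤ :=
    ENNReal.mul_ne_top (ENNReal.rpow_ne_top_of_nonneg hs0.le ENNReal.ofReal_ne_top) hC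
  refine ⟨(ENNReal.ofReal M ^ s * C).toReal + 1, by positivity, fun bl br z hz a b =>
    ⟨fun ω => isUnit_sub_smul_id_of_mem_unitary (zipper_mem_unitary hα.le bl br a b ω) hz,
      fun k l hkl => ?_⟩⟩
  have hmeas : Measurable fun ω => subordinateNorm N (green α bl br a b ω z k l) ^ s :=
    (measurable_subordinateNorm hN (measurable_op_green hα.le hz k l)).pow_const s
  have hle : ∫⁻ ω, ‖subordinateNorm N (green α bl br a b ω z k l) ^ s‖ₑ ∂(law L p) ≤
      ENNReal.ofReal M ^ s * C := by
    simp only [Real.enorm_rpow_of_nonneg (subordinateNorm_nonneg N _) hs0.le]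
    refine (lintegral_enorm_rpow_le_of_norm_le_mul hM.le hs0.le fun ω => ?_).trans
      (mul_le_mul_right (hCle bl br z hz a b k l hkl) _)
    rw [Real.norm_of_nonneg (subordinateNorm_nonneg N _)]
    exact hNM _
  exact (integrable_and_integral_le_of_lintegral_enorm_le hmeas.aestronglyMeasurable htop
    hle).imp_right (le_add_of_le_of_nonneg · zero_le_one)

theorem mainTheorem5 (L : ℕ) (hL : 1 ≤ L)
    (p : ℝ) (hp0 : 0 < p) (hp1 : p < 1)
    (α : Matrix (Fin L) (Fin L) ℂ) (hα : ‖op α‖ < 1)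
    (N : Seminorm ℂ (Fin L → ℂ)) (hN : ∀ x, N x = 0 → x = 0)
    (s : ℝ) (hs0 : 0 < s) (hs1 : s < 1 / 4) :
    ∃ C : ℝ, 0 < C ∧
      ∀ (bl br : UL L) (z : ℂ), ‖z‖ ≠ 1 →
      ∀ a b : WithBot (WithTop ℤ), a < b →
        (∀ ω : Sample L,
          IsUnit (zipper α bl br a b ω - z • ContinuousLinearMap.id ℂ (Hil L (sites a b)))) ∧
        ∀ k l : sites a b, 4 < |(k : ℤ) - (l : ℤ)| →
          Integrable (fun ω => subordinateNorm N (green α bl br a b ω z k l) ^ s) (law L p) ∧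
          ∫ ω, subordinateNorm N (green α bl br a b ω z k l) ^ s ∂(law L p) ≤ C :=
  (mainTheorem5_general hp0.le hp1.le hα hN hs0 (hs1.trans (by norm_num))).imp fun _ hC =>
    ⟨hC.1, fun bl br z hz a b _ => (hC.2 bl br z hz a b).imp_right
      fun hG k l hkl => hG k l (lt_trans (by norm_num) hkl)⟩
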